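/- Let $z_0\in(0,1)$, $\beta=1+\alpha$ with $0<\alpha<1$, $\varsigma\ge 1$, $L>0$, $y_0\in\mathbb R$, and let $(\epsilon^*_n)_{n\ge1}$ be a sequence of nonnegative numbers with $\epsilon^*_n\to0$. For $n\ge 1$ consider the observations $$y_k=S(k/n)\,y_{k-1}+\xi_k,\qquad 1\le k\le n,$$ started at the fixed value $y_0$, where $\xi_1,\dots,\xi_n$ are i.i.d. with a Lebesgue density $p$ belonging to the class $$\mathcal P_\varsigma=\Big\{p\ge0:\ \int p(x)\,dx=1,\ \int x\,p(x)\,dx=0,\ \int x^2p(x)\,dx=1,\ \sup_{k\ge1}\frac{1}{\varsigma^k(2k-1)!!}\int|x|^{2k}p(x)\,dx\le1\Big\}.$$ Write $\mathbf E_{S,p}$ for the expectation under the law of $(y_1,\dots,y_n)$. For $0<\varepsilon<1$ let $\Theta_{\varepsilon,L}$ be the set of continuously differentiable $S:[0,1]\to\mathbb R$ with $\sup_{[0,1]}|S|\le1-\varepsilon$ and $\sup_{[0,1]}|S'|\le L$, and, with $h=h_n=n^{-1/(2\beta+1)}$ (and $n$ so large that $[z_0-h,z_0+h]\subset[0,1]$),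 let $$\mathcal U_n^{(\beta)}(\varepsilon,L,\epsilon^*_n)=\Big\{S\in\Theta_{\varepsilon,L}:\ \Big|\int_{-1}^1\big(S(z_0+uh)-S(z_0)\big)\,du\Big|\le\epsilon^*_n h^\beta\Big\}.$$ For an estimator $\widetilde S_n$ of $S(z_0)$, i.e. a real-valued measurable function of $(y_1,\dots,y_n)$, define the robust risk $$\mathcal R_n(\widetilde S_n,S)=\sup_{p\in\mathcal P_\varsigma}\mathbf E_{S,p}\big|\widetilde S_n-S(z_0)\big|\in[0,\infty],$$ and put $\gamma(S)=1-S^2(z_0)$, $\varphi_n=n^{\beta/(2\beta+1)}$. Then for every $0<\varepsilon<1$, $$\liminf_{n\to\infty}\ \inf_{\widetilde S_n}\ \sup_{S\in\mathcal U_n^{(\beta)}(\varepsilon,L,\epsilon^*_n)}\gamma^{-1/2}(S)\,\varphi_n\,\mathcal R_n(\widetilde S_n,S)\ \ge\ \mathbf E|\eta|,$$ where the infimum is over all estimators and $\eta$ is a Gaussian random variable with mean $0$ and variance $1/2$. -/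

import Mathlib

open MeasureTheory ProbabilityTheory Filter Set
open scoped Nat

namespace NonparamAR

noncomputable section

/-- The class of noise densities with parameter `ς`: probability densities on the real line with
mean zero, unit variance and, for every `k ≥ 1`, `2k`-th moment at most `ς ^ k * (2k - 1)!!`.
(A Bochner integral equal to `1` is that of an integrable function; the integrability of
`x * p x` follows from that of `p x` and `x ^ 2 * p x`.) -/
structure IsNoiseDensity (ς : ℝ) (p : ℝ → ℝ) : Prop where
  measurable : Measurable p
  nonneg : ∀ x, 0 ≤ p x
  integral_eq_one : ∫ x, p x = 1
  mean_eq_zero : ∫ x, x * p x = 0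
  variance_eq_one : ∫ x, x ^ 2 * p x = 1
  integrable_moment : ∀ k : ℕ, 1 ≤ k → Integrable (fun x => |x| ^ (2 * k) * p x)
  moment_le : ∀ k : ℕ, 1 ≤ k →
    1 / (ς ^ k * ((2 * k - 1)‼ : ℝ)) * ∫ x, |x| ^ (2 * k) * p x ≤ 1

/-- The law on the real line with Lebesgue density `p`. -/
def noiseLaw (p : ℝ → ℝ) : Measure ℝ :=
  volume.withDensity fun x => ENNReal.ofReal (p x)

/-- The autoregression `y_k = S (k / n) * y_{k-1} + ξ_k`, `1 ≤ k ≤ n`, started at `y0`.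
The noise `ξ_k` is the coordinate of index `k - 1` of `ξ`. (Only `k ≤ n` is ever used.) -/
def arPath (S : ℝ → ℝ) (y0 : ℝ) (n : ℕ) (ξ : Fin n → ℝ) : ℕ → ℝ
  | 0 => y0
  | k + 1 => S (((k + 1 : ℕ) : ℝ) / (n : ℝ)) * arPath S y0 n ξ k
      + (if h : k < n then ξ ⟨k, h⟩ else 0)

/-- The vector of observations `(y_1, …, y_n)`. -/
def arObs (S : ℝ → ℝ) (y0 : ℝ) (n : ℕ) (ξ : Fin n → ℝ) : Fin n → ℝ :=
  fun i => arPath S y0 n ξ (i + 1)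

theorem measurable_arPath (S : ℝ → ℝ) (y0 : ℝ) (n k : ℕ) :
    Measurable fun ξ : Fin n → ℝ => arPath S y0 n ξ k := by
  induction k with
  | zero => exact measurable_const
  | succ k ih =>
    simp only [arPath]
    refine (ih.const_mul _).add ?_
    split_ifs with h
    · exact measurable_pi_apply _
    · exact measurable_const

theorem measurable_arObs (S : ℝ → ℝ) (y0 : ℝ) (n : ℕ) : Measurable (arObs S y0 n) :=
  measurable_pi_lambda _ fun _ => measurable_arPath S y0 n _

/-- The distribution of `(y_1, …, y_n)` when `ξ_1, …, ξ_n` are i.i.d. with density `p`. -/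
def obsLaw (S p : ℝ → ℝ) (y0 : ℝ) (n : ℕ) : Measure (Fin n → ℝ) :=
  (Measure.pi fun _ : Fin n => noiseLaw p).map (arObs S y0 n)

/-- The stability set: continuously differentiable functions on `[0, 1]` with `‖S‖ ≤ 1 - ε` and
`‖S'‖ ≤ L` in the supremum norm on `[0, 1]`. Functions on `[0, 1]` are represented by functions
on the real line, whose values off `[0, 1]` are ignored. -/
def stabilitySet (ε L : ℝ) : Set (ℝ → ℝ) :=
  {S | ContDiffOn ℝ 1 S (Icc 0 1) ∧ (∀ x ∈ Icc (0 : ℝ) 1, |S x| ≤ 1 - ε) ∧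
    ∀ x ∈ Icc (0 : ℝ) 1, |derivWithin S (Icc 0 1) x| ≤ L}

/-- `Ω_h(z₀, S) = ∫_{-1}^{1} (S (z₀ + u h) - S z₀) du`. -/
def Omega (h z₀ : ℝ) (S : ℝ → ℝ) : ℝ :=
  ∫ u in (-1 : ℝ)..1, (S (z₀ + u * h) - S z₀)

/-- The bandwidth `h = n ^ (-1 / (2 β + 1))`. -/
def bandwidth (β : ℝ) (n : ℕ) : ℝ := (n : ℝ) ^ (-(1 / (2 * β + 1)))

/-- The weak stable local Hölder class at `z₀` for the sample size `n`, with weak Hölder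
constant `c`. For all large `n` the interval `[z₀ - h, z₀ + h]` lies in `[0, 1]`. -/
def weakHolderClass (β ε L z₀ c : ℝ) (n : ℕ) : Set (ℝ → ℝ) :=
  {S | S ∈ stabilitySet ε L ∧ |Omega (bandwidth β n) z₀ S| ≤ c * bandwidth β n ^ β}

/-- `γ(S) = 1 - S(z₀)²`. -/
def gam (z₀ : ℝ) (S : ℝ → ℝ) : ℝ := 1 - S z₀ ^ 2

/-- The normalizing coefficient `φ_n = n ^ (β / (2 β + 1))`. -/
def rate (β : ℝ) (n : ℕ) : ℝ := (n : ℝ) ^ (β / (2 * β + 1))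

/-- The robust risk at `S` of the estimator `T` of `S z₀`: the supremum over the noise densities
of the mean absolute error, as an extended nonnegative number. -/
def robustRisk (ς y0 z₀ : ℝ) (n : ℕ) (T : (Fin n → ℝ) → ℝ) (S : ℝ → ℝ) : ENNReal :=
  ⨆ (p : ℝ → ℝ) (_ : IsNoiseDensity ς p),
    ∫⁻ y, ENNReal.ofReal |T y - S z₀| ∂(obsLaw S p y0 n)

/-- The minimax risk over the weak Hölder class, normalized by `γ(S) ^ (-1/2) * φ_n`; the infimum
is over all measurable functions of the observations. -/
def minimaxRisk (ς y0 z₀ β ε L c : ℝ) (n : ℕ) : ENNReal :=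
  ⨅ (T : (Fin n → ℝ) → ℝ) (_ : Measurable T),
    ⨆ S ∈ weakHolderClass β ε L z₀ c n,
      ENNReal.ofReal (gam z₀ S ^ (-(1 / 2) : ℝ)) * ENNReal.ofReal (rate β n)
        * robustRisk ς y0 z₀ n T S

end

end NonparamAR

/-! The supremum is restricted to standard Gaussian noise and to the curves S_u(x) = (u/ρ) χ((x -
z₀)/h), |u| ≤ b, where ρ = φ_n = √(nh) and χ is a smooth plateau equal to 1 on [-1, 1]. On these
curves Ω_h vanishes, so the weak Hölder condition is free; their size is O(1/ρ), and their slope is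
O(1/(ρh)), which tends to 0 because β > 1. Since γ(S_u) ≤ 1, the factor γ^(-1/2) can be dropped.
Estimating S_u(z₀) = u/ρ with loss scaled by ρ is estimating u.

Relative to pure noise (S = 0), the log-likelihood of S_u is exactly u D - u² I / 2, where I = ρ⁻² ∑
χ² y² is the observed information (`lintegral_recObs`, `exp_arLogLik`). The coefficients are O(1/ρ),
so each lagged y is close to a noise variable, and I concentrates near ρ⁻² ∑ χ², which is 2 up to a
tolerance governed by δ (`measure_arInfo_not_mem_le`, `sum_plateau_sq_bounds`). The experiment is
therefore almost a Gaussian shift with information 2.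

The worst risk is at least the average risk under the uniform prior on [-b, b]
(`le_of_forall_lintegral_quadLik_le`). For fixed data the likelihood in u is a Gaussian bell with
centre D/I and variance 1/I. Within distance a of D/I, no estimate has a smaller weighted absolute
error than the centre itself (`integral_abs_sub_mul_exp_ge`), and this window usually lies inside
the prior interval. As n → ∞ and then b, a → ∞ with a/b → 0 and δ → 0, the bound becomes 1/√π, the
mean of |η|. -/

namespace NonparamAR

/-! ### Quadratic likelihoods for one fixed observation -/

/-- The likelihood ratio `exp (u D - u² I / 2)` of a locally Gaussian experiment. -/
noncomputable def quadLik (u D I : ℝ) : ℝ := Real.exp (u * D - u ^ 2 * I / 2)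

theorem quadLik_pos (u D I : ℝ) : 0 < quadLik u D I := Real.exp_pos _

@[fun_prop]
theorem continuous_quadLik (D I : ℝ) : Continuous fun u => quadLik u D I := by
  unfold quadLik; fun_prop

theorem measurable_quadLik {Ω : Type*} [MeasurableSpace Ω] {f g h : Ω → ℝ}
    (hf : Measurable f) (hg : Measurable g) (hh : Measurable h) :
    Measurable fun ω => quadLik (f ω) (g ω) (h ω) := by
  unfold quadLik; fun_prop

/-- Completing the square: in u, the likelihood is an unnormalized Gaussian centred at its maximizer
D/I. -/
theorem quadLik_add_div (v D : ℝ) {I : ℝ} (hI : 0 < I) :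
    quadLik (D / I + v) D I = Real.exp (D ^ 2 / (2 * I)) * Real.exp (-(I / 2) * v ^ 2) := by
  rw [quadLik, ← Real.exp_add]
  congr 1
  field_simp
  ring

/-- The log-ratio of the likelihoods at u + a and u is a(D - uI) - a²I/2. When the maximizer exceeds
u by at least a, it is at least a²I/2. -/
theorem quadLik_le_quadLik_add {a u D I lo : ℝ} (ha : 0 < a) (hlo : 0 < lo) (hI : lo ≤ I)
    (h : a ≤ D / I - u) :
    quadLik u D I ≤ Real.exp (-(lo * a ^ 2 / 2)) * quadLik (u + a) D I := by
  have hI0 : 0 < I := hlo.trans_le hI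
  rw [quadLik, quadLik, ← Real.exp_add]
  apply Real.exp_le_exp.mpr
  have h1 : (a + u) * I ≤ D := by
    rw [← le_div_iff₀ hI0]; linarith
  nlinarith [mul_le_mul_of_nonneg_right hI (sq_nonneg a), mul_le_mul_of_nonneg_left h1 ha.le]

theorem quadLik_neg_neg (u D I : ℝ) : quadLik (-u) (-D) I = quadLik u D I := by
  simp [quadLik]

theorem integral_id_mul_exp_neg_mul_sq (a : ℝ) {c : ℝ} (hc : 0 < c) :
    ∫ v in (0 : ℝ)..a, 2 * v * Real.exp (-(c / 2) * v ^ 2)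
      = 2 / c * (1 - Real.exp (-(c * a ^ 2 / 2))) := by
  have hderiv : ∀ v ∈ uIcc (0 : ℝ) a,
      HasDerivAt (fun v => -(2 / c) * Real.exp (-(c / 2) * v ^ 2))
        (2 * v * Real.exp (-(c / 2) * v ^ 2)) v := by
    intro v _
    have h := ((((hasDerivAt_id v).pow 2).const_mul (-(c / 2))).exp).const_mul (-(2 / c))
    refine h.congr_deriv ?_
    simp
    field_simp
  rw [intervalIntegral.integral_eq_sub_of_hasDerivAt hderiv
    (Continuous.intervalIntegrable (by fun_prop) _ _)]
  rw [show -(c / 2) * a ^ 2 = -(c * a ^ 2 / 2) by ring]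
  simp
  ring

/-- Pairing v with -v and using |t - v| + |t + v| ≥ 2v shows that t = 0 is the best centre.
Replacing I by `hi` then gives a closed form independent of the data. -/
theorem integral_abs_sub_mul_exp_ge (t : ℝ) {a I hi : ℝ} (ha : 0 < a) (hI : 0 < I)
    (hIhi : I ≤ hi) :
    2 / hi * (1 - Real.exp (-(hi * a ^ 2 / 2)))
      ≤ ∫ v in (-a)..a, |t - v| * Real.exp (-(I / 2) * v ^ 2) := by
  have hint : ∀ x y : ℝ, IntervalIntegrable (fun v => |t - v| * Real.exp (-(I / 2) * v ^ 2))
      volume x y := fun x y => Continuous.intervalIntegrable (by fun_prop) _ _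
  rw [← intervalIntegral.integral_add_adjacent_intervals (hint (-a) 0) (hint 0 a)]
  have h1 : ∫ v in (-a)..0, |t - v| * Real.exp (-(I / 2) * v ^ 2)
      = ∫ v in (0 : ℝ)..a, |t + v| * Real.exp (-(I / 2) * v ^ 2) := by
    have h := intervalIntegral.integral_comp_neg (a := 0) (b := a)
      (fun v => |t - v| * Real.exp (-(I / 2) * v ^ 2))
    simp at h
    simpa using h.symm
  rw [h1, ← intervalIntegral.integral_add (Continuous.intervalIntegrable (by fun_prop) _ _)
    (hint _ _), ← integral_id_mul_exp_neg_mul_sq a (hI.trans_le hIhi)]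
  refine intervalIntegral.integral_mono_on ha.le (Continuous.intervalIntegrable (by fun_prop) _ _)
    (Continuous.intervalIntegrable (by fun_prop) _ _) fun v hv => ?_
  have hv0 : 0 ≤ v := hv.1
  rw [← add_mul]
  have h2 : 2 * v ≤ |t + v| + |t - v| := by
    have := abs_sub (t + v) (t - v)
    rw [show t + v - (t - v) = 2 * v by ring] at this
    exact (le_abs_self _).trans this
  have h3 : Real.exp (-(hi / 2) * v ^ 2) ≤ Real.exp (-(I / 2) * v ^ 2) := by
    apply Real.exp_le_exp.mpr
    nlinarith [mul_le_mul_of_nonneg_right hIhi (sq_nonneg v)]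
  exact mul_le_mul h2 h3 (Real.exp_pos _).le (by positivity)

theorem lintegral_abs_sub_mul_quadLik_ge (t D : ℝ) {a I hi : ℝ} (ha : 0 < a) (hI : 0 < I)
    (hIhi : I ≤ hi) :
    ENNReal.ofReal (Real.exp (D ^ 2 / (2 * I)) * (2 / hi * (1 - Real.exp (-(hi * a ^ 2 / 2)))))
      ≤ ∫⁻ u in Icc (D / I - a) (D / I + a),
          ENNReal.ofReal |t - u| * ENNReal.ofReal (quadLik u D I) := by
  have hcont : Continuous fun u => |t - u| * quadLik u D I := by fun_prop
  simp_rw [← ENNReal.ofReal_mul (abs_nonneg _)]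
  rw [← ofReal_integral_eq_lintegral_ofReal
    (hcont.continuousOn.integrableOn_compact isCompact_Icc)
    (ae_of_all _ fun u => mul_nonneg (abs_nonneg _) (quadLik_pos _ _ _).le)]
  apply ENNReal.ofReal_le_ofReal
  rw [integral_Icc_eq_integral_Ioc, ← intervalIntegral.integral_of_le (by linarith)]
  have h := intervalIntegral.integral_comp_add_left (a := -a) (b := a)
    (fun u => |t - u| * quadLik u D I) (D / I)
  rw [sub_eq_add_neg (D / I) a, ← h]
  simp_rw [quadLik_add_div _ D hI]
  have h2 : ∀ v : ℝ, |t - (D / I + v)| *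
      (Real.exp (D ^ 2 / (2 * I)) * Real.exp (-(I / 2) * v ^ 2))
      = Real.exp (D ^ 2 / (2 * I)) * (|(t - D / I) - v| * Real.exp (-(I / 2) * v ^ 2)) := by
    intro v
    rw [sub_add_eq_sub_sub]; ring
  simp_rw [h2]
  rw [intervalIntegral.integral_const_mul]
  exact mul_le_mul_of_nonneg_left (integral_abs_sub_mul_exp_ge _ ha hI hIhi) (Real.exp_pos _).le

theorem lintegral_quadLik (D : ℝ) {I : ℝ} (hI : 0 < I) :
    ∫⁻ u, ENNReal.ofReal (quadLik u D I)
      = ENNReal.ofReal (Real.exp (D ^ 2 / (2 * I)) * √(2 * Real.pi / I)) := by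
  rw [← lintegral_add_left_eq_self _ (D / I)]
  simp_rw [quadLik_add_div _ D hI]
  rw [← ofReal_integral_eq_lintegral_ofReal
    ((integrable_exp_neg_mul_sq (by positivity)).const_mul _)
    (ae_of_all _ fun u => by positivity), integral_const_mul, integral_gaussian]
  congr 3
  field_simp

/-- A lower bound of the average over a uniform prior on `[-b, b]`, for a fixed observation. -/
theorem lintegral_prior_ge (t D : ℝ) {a b I lo hi : ℝ} (ha : 0 < a) (hlo : 0 < lo) (hloI : lo ≤ I)
    (hIhi : I ≤ hi) (hm : |D / I| ≤ b - a) (A : Set ℝ) :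
    ENNReal.ofReal (√(lo / (2 * Real.pi)) * (2 / hi * (1 - Real.exp (-(hi * a ^ 2 / 2)))))
        * ∫⁻ u in A, ENNReal.ofReal (quadLik u D I)
      ≤ ∫⁻ u in Icc (-b) b, ENNReal.ofReal |t - u| * ENNReal.ofReal (quadLik u D I) := by
  have hI : 0 < I := hlo.trans_le hloI
  have hhi : 0 < hi := hI.trans_le hIhi
  have hr : 0 ≤ 2 / hi * (1 - Real.exp (-(hi * a ^ 2 / 2))) := by
    have : Real.exp (-(hi * a ^ 2 / 2)) ≤ 1 := Real.exp_le_one_iff.mpr (by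
      have : 0 ≤ hi * a ^ 2 / 2 := by positivity
      linarith)
    exact mul_nonneg (by positivity) (by linarith)
  have hsub : Icc (D / I - a) (D / I + a) ⊆ Icc (-b) b := by
    intro u hu
    have := abs_le.mp hm
    exact ⟨by linarith [hu.1], by linarith [hu.2]⟩
  refine le_trans ?_ ((lintegral_abs_sub_mul_quadLik_ge t D ha hI hIhi).trans
    (lintegral_mono_set hsub))
  -- The total mass of the likelihood is exp(D²/2I) √(2π/I). The exponential also appears in the
  -- lower bound, and √(2π/I) is absorbed by √(lo/2π) because lo ≤ I.
  refine (mul_le_mul_right (setLIntegral_le_lintegral A _) _).trans ?_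
  rw [lintegral_quadLik D hI, ← ENNReal.ofReal_mul (by positivity)]
  apply ENNReal.ofReal_le_ofReal
  have hs : √(lo / (2 * Real.pi)) * √(2 * Real.pi / I) ≤ 1 := by
    rw [← Real.sqrt_mul (by positivity)]
    apply Real.sqrt_le_one.mpr
    rw [div_mul_div_comm, div_le_one (by positivity)]
    nlinarith [Real.pi_pos]
  calc _ = (√(lo / (2 * Real.pi)) * √(2 * Real.pi / I)) *
        (Real.exp (D ^ 2 / (2 * I)) * (2 / hi * (1 - Real.exp (-(hi * a ^ 2 / 2))))) := by ring
    _ ≤ _ := mul_le_of_le_one_left (mul_nonneg (Real.exp_pos _).le hr) hs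

/-! ### Bayes risk in an experiment with quadratic likelihood -/

section LocalExperiment

variable {Ω : Type*} [MeasurableSpace Ω] {P : Measure Ω} {D I : Ω → ℝ}

/-- Deviation bound for the likelihood maximizer, by a change of parameter. -/
theorem lintegral_quadLik_deviation_le
    (hL : ∀ u, ∫⁻ ω, ENNReal.ofReal (quadLik u (D ω) (I ω)) ∂P = 1) {a lo : ℝ} (ha : 0 < a)
    (hlo : 0 < lo) (u : ℝ) {s : Set Ω} (hs : MeasurableSet s)
    (h : ∀ ω ∈ s, lo ≤ I ω ∧ a ≤ D ω / I ω - u) :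
    ∫⁻ ω in s, ENNReal.ofReal (quadLik u (D ω) (I ω)) ∂P
      ≤ ENNReal.ofReal (Real.exp (-(lo * a ^ 2 / 2))) := by
  calc _ ≤ ∫⁻ ω in s, ENNReal.ofReal (Real.exp (-(lo * a ^ 2 / 2))) *
            ENNReal.ofReal (quadLik (u + a) (D ω) (I ω)) ∂P := by
        refine setLIntegral_mono' hs fun ω hω => ?_
        rw [← ENNReal.ofReal_mul (Real.exp_pos _).le]
        exact ENNReal.ofReal_le_ofReal (quadLik_le_quadLik_add ha hlo (h ω hω).1 (h ω hω).2)
    _ = ENNReal.ofReal (Real.exp (-(lo * a ^ 2 / 2))) *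
          ∫⁻ ω in s, ENNReal.ofReal (quadLik (u + a) (D ω) (I ω)) ∂P :=
        lintegral_const_mul' _ _ ENNReal.ofReal_ne_top
    _ ≤ ENNReal.ofReal (Real.exp (-(lo * a ^ 2 / 2))) * 1 := by
        gcongr
        exact (setLIntegral_le_lintegral _ _).trans (hL _).le
    _ = _ := mul_one _

/-- For a parameter u at distance 2a from the ends of the prior, |D/I| > b - a forces the maximizer
to miss u by more than a. Each side of this event has probability at most exp(-lo a²/2), and η
accounts for atypical information. -/
theorem lintegral_quadLik_good_ge (hD : Measurable D) (hI : Measurable I)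
    (hL : ∀ u, ∫⁻ ω, ENNReal.ofReal (quadLik u (D ω) (I ω)) ∂P = 1)
    {a b lo hi η u : ℝ} (ha : 0 < a) (hlo : 0 < lo) (hη0 : 0 ≤ η) (hu : |u| ≤ b - 2 * a)
    (hη : ∫⁻ ω in {ω | ¬(lo ≤ I ω ∧ I ω ≤ hi)}, ENNReal.ofReal (quadLik u (D ω) (I ω)) ∂P
      ≤ ENNReal.ofReal η) :
    ENNReal.ofReal (1 - η - 2 * Real.exp (-(lo * a ^ 2 / 2)))
      ≤ ∫⁻ ω in {ω | |D ω / I ω| ≤ b - a ∧ lo ≤ I ω ∧ I ω ≤ hi},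
          ENNReal.ofReal (quadLik u (D ω) (I ω)) ∂P := by
  set ℓ : Ω → ENNReal := fun ω => ENNReal.ofReal (quadLik u (D ω) (I ω)) with hℓ
  set G := {ω | |D ω / I ω| ≤ b - a ∧ lo ≤ I ω ∧ I ω ≤ hi}
  set B := {ω | ¬(lo ≤ I ω ∧ I ω ≤ hi)}
  set C₁ := {ω | lo ≤ I ω ∧ a ≤ D ω / I ω - u}
  set C₂ := {ω | lo ≤ I ω ∧ a ≤ -(D ω) / I ω - -u}
  have hC₁ : MeasurableSet C₁ := (measurableSet_le measurable_const hI).inter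
    (measurableSet_le measurable_const ((hD.div hI).sub_const u))
  have hC₂ : MeasurableSet C₂ := (measurableSet_le measurable_const hI).inter
    (measurableSet_le measurable_const ((hD.neg.div hI).sub_const (-u)))
  have h1 : ∫⁻ ω in C₁, ℓ ω ∂P ≤ ENNReal.ofReal (Real.exp (-(lo * a ^ 2 / 2))) :=
    lintegral_quadLik_deviation_le hL ha hlo u hC₁ fun ω hω => hω
  have h2 : ∫⁻ ω in C₂, ℓ ω ∂P ≤ ENNReal.ofReal (Real.exp (-(lo * a ^ 2 / 2))) := by
    -- Changing the signs of both u and D preserves the likelihood, so the lower deviation reduces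
    -- to the upper one.
    have hL' : ∀ u, ∫⁻ ω, ENNReal.ofReal (quadLik u (-(D ω)) (I ω)) ∂P = 1 := fun u => by
      simpa only [quadLik_neg_neg, neg_neg] using hL (-u) ▸ congrArg (fun f => ∫⁻ ω, f ω ∂P)
        (funext fun ω => by rw [← quadLik_neg_neg u, neg_neg])
    have := lintegral_quadLik_deviation_le (D := fun ω => -(D ω)) hL' ha hlo (-u) hC₂
      fun ω hω => hω
    simpa only [quadLik_neg_neg] using this
  have hcov : (univ : Set Ω) ⊆ G ∪ (B ∪ (C₁ ∪ C₂)) := by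
    intro ω _
    by_cases hB : lo ≤ I ω ∧ I ω ≤ hi
    · by_cases hm : |D ω / I ω| ≤ b - a
      · exact Or.inl ⟨hm, hB⟩
      · right; right
        have hu' := abs_le.mp hu
        rcases lt_abs.mp (not_le.mp hm) with h | h
        · exact Or.inl ⟨hB.1, by linarith⟩
        · refine Or.inr ⟨hB.1, ?_⟩
          rw [neg_div]; linarith
    · exact Or.inr (Or.inl hB)
  have hsum : (1 : ENNReal) ≤ (∫⁻ ω in G, ℓ ω ∂P) + (ENNReal.ofReal η +
      (ENNReal.ofReal (Real.exp (-(lo * a ^ 2 / 2))) +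
        ENNReal.ofReal (Real.exp (-(lo * a ^ 2 / 2))))) := by
    calc (1 : ENNReal) = ∫⁻ ω in univ, ℓ ω ∂P := by rw [setLIntegral_univ, hL]
      _ ≤ ∫⁻ ω in G ∪ (B ∪ (C₁ ∪ C₂)), ℓ ω ∂P := lintegral_mono_set hcov
      _ ≤ (∫⁻ ω in G, ℓ ω ∂P) + ((∫⁻ ω in B, ℓ ω ∂P) +
            ((∫⁻ ω in C₁, ℓ ω ∂P) + ∫⁻ ω in C₂, ℓ ω ∂P)) := by
          refine (lintegral_union_le _ _ _).trans (add_le_add le_rfl ?_)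
          refine (lintegral_union_le _ _ _).trans (add_le_add le_rfl ?_)
          exact lintegral_union_le _ _ _
      _ ≤ _ := by gcongr
  rw [← ENNReal.ofReal_add (Real.exp_pos _).le (Real.exp_pos _).le,
    ← ENNReal.ofReal_add hη0 (by positivity)] at hsum
  rw [sub_sub, ENNReal.ofReal_sub _ (by positivity), ENNReal.ofReal_one, two_mul]
  exact tsub_le_iff_right.mpr hsum

/-- Lower bound of the worst-case mean absolute error on `[-b, b]` in an experiment whose
likelihood ratios are quadratic with nearly deterministic curvature. -/
theorem le_of_forall_lintegral_quadLik_le [SFinite P] (hD : Measurable D) (hI : Measurable I)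
    {T : Ω → ℝ} (hT : Measurable T)
    (hL : ∀ u, ∫⁻ ω, ENNReal.ofReal (quadLik u (D ω) (I ω)) ∂P = 1)
    {a b lo hi η : ℝ} (ha : 0 < a) (hab : 2 * a < b) (hlo : 0 < lo) (hlohi : lo ≤ hi)
    (hη0 : 0 ≤ η)
    (hη : ∀ u, |u| ≤ b → ∫⁻ ω in {ω | ¬(lo ≤ I ω ∧ I ω ≤ hi)},
      ENNReal.ofReal (quadLik u (D ω) (I ω)) ∂P ≤ ENNReal.ofReal η)
    {R : ENNReal} (hR : ∀ u, |u| ≤ b →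
      ∫⁻ ω, ENNReal.ofReal |T ω - u| * ENNReal.ofReal (quadLik u (D ω) (I ω)) ∂P ≤ R) :
    ENNReal.ofReal ((b - 2 * a) / b *
        (√(lo / (2 * Real.pi)) * (2 / hi * (1 - Real.exp (-(hi * a ^ 2 / 2))))) *
        (1 - η - 2 * Real.exp (-(lo * a ^ 2 / 2)))) ≤ R := by
  have hb : 0 < b := by linarith
  set K := √(lo / (2 * Real.pi)) * (2 / hi * (1 - Real.exp (-(hi * a ^ 2 / 2)))) with hK
  set q := 1 - η - 2 * Real.exp (-(lo * a ^ 2 / 2)) with hq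
  have hK0 : 0 ≤ K := by
    have hhi : 0 < hi := hlo.trans_le hlohi
    have : Real.exp (-(hi * a ^ 2 / 2)) ≤ 1 := Real.exp_le_one_iff.mpr (by
      have : 0 ≤ hi * a ^ 2 / 2 := by positivity
      linarith)
    exact mul_nonneg (by positivity) (mul_nonneg (by positivity) (by linarith))
  set G := {ω | |D ω / I ω| ≤ b - a ∧ lo ≤ I ω ∧ I ω ≤ hi} with hG
  have hGm : MeasurableSet G := by
    have hm : Measurable fun ω => |D ω / I ω| := (hD.div hI).abs
    exact (measurableSet_le hm measurable_const).inter
      ((measurableSet_le measurable_const hI).inter (measurableSet_le hI measurable_const))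
  have hmeas : Measurable (fun p : ℝ × Ω => ENNReal.ofReal (quadLik p.1 (D p.2) (I p.2))) :=
    (measurable_quadLik measurable_fst (hD.comp measurable_snd)
      (hI.comp measurable_snd)).ennreal_ofReal
  have hmeas2 : Measurable (fun p : ℝ × Ω =>
      ENNReal.ofReal |T p.2 - p.1| * ENNReal.ofReal (quadLik p.1 (D p.2) (I p.2))) :=
    (((hT.comp measurable_snd).sub measurable_fst).abs.ennreal_ofReal).mul hmeas
  set J := Icc (-(b - 2 * a)) (b - 2 * a) with hJ
  -- Fubini is used twice: to pass from the probability of the good event, averaged over the inner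
  -- interval `J`, to an integral over observations, and then to return from the pointwise prior
  -- bound to risks. The ratio (b - 2a)/b is the relative length of `J`.
  have key : ENNReal.ofReal K * (ENNReal.ofReal q * ENNReal.ofReal (2 * (b - 2 * a)))
      ≤ R * ENNReal.ofReal (2 * b) := by
    calc ENNReal.ofReal K * (ENNReal.ofReal q * ENNReal.ofReal (2 * (b - 2 * a)))
        = ENNReal.ofReal K * ∫⁻ _ in J, ENNReal.ofReal q := by
          rw [setLIntegral_const, hJ, Real.volume_Icc]; ring_nf
      _ ≤ ENNReal.ofReal K *
            ∫⁻ u in J, ∫⁻ ω in G, ENNReal.ofReal (quadLik u (D ω) (I ω)) ∂P := by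
          refine mul_le_mul_right ?_ _
          refine setLIntegral_mono' measurableSet_Icc fun u hu => ?_
          have hu' : |u| ≤ b - 2 * a := abs_le.mpr hu
          exact lintegral_quadLik_good_ge hD hI hL ha hlo hη0 hu' (hη u (by linarith))
      _ = ENNReal.ofReal K *
            ∫⁻ ω in G, (∫⁻ u in J, ENNReal.ofReal (quadLik u (D ω) (I ω))) ∂P := by
          rw [lintegral_lintegral_swap hmeas.aemeasurable]
      _ = ∫⁻ ω in G, (ENNReal.ofReal K *
            ∫⁻ u in J, ENNReal.ofReal (quadLik u (D ω) (I ω))) ∂P :=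
          (lintegral_const_mul' _ _ ENNReal.ofReal_ne_top).symm
      _ ≤ ∫⁻ ω in G, (∫⁻ u in Icc (-b) b,
            ENNReal.ofReal |T ω - u| * ENNReal.ofReal (quadLik u (D ω) (I ω))) ∂P :=
          setLIntegral_mono' hGm fun ω hω =>
            lintegral_prior_ge (T ω) (D ω) ha hlo hω.2.1 hω.2.2 hω.1 J
      _ ≤ ∫⁻ ω, (∫⁻ u in Icc (-b) b,
            ENNReal.ofReal |T ω - u| * ENNReal.ofReal (quadLik u (D ω) (I ω))) ∂P :=
          setLIntegral_le_lintegral _ _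
      _ = ∫⁻ u in Icc (-b) b, ∫⁻ ω,
            ENNReal.ofReal |T ω - u| * ENNReal.ofReal (quadLik u (D ω) (I ω)) ∂P := by
          exact (lintegral_lintegral_swap hmeas2.aemeasurable).symm
      _ ≤ ∫⁻ _ in Icc (-b) b, R :=
          setLIntegral_mono' measurableSet_Icc fun u hu => hR u (abs_le.mpr hu)
      _ = R * ENNReal.ofReal (2 * b) := by
          rw [setLIntegral_const, Real.volume_Icc]; ring_nf
  have hb2 : ENNReal.ofReal (2 * b) ≠ 0 := by simpa using hb
  rw [← ENNReal.mul_le_mul_iff_left hb2 ENNReal.ofReal_ne_top]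
  refine le_trans (le_of_eq ?_) key
  have hc : 0 ≤ (b - 2 * a) / b := div_nonneg (by linarith) hb.le
  rw [ENNReal.ofReal_mul (mul_nonneg hc hK0), mul_comm ((b - 2 * a) / b) K, ENNReal.ofReal_mul hK0,
    show 2 * (b - 2 * a) = (b - 2 * a) / b * (2 * b) by field_simp, ENNReal.ofReal_mul hc]
  ring

end LocalExperiment

/-! ### The autoregressive recursion and its Gaussian likelihood -/

/-- The linear recursion `y_{k+1} = s_{k+1} y_k + ξ_k` with arbitrary coefficients. -/
noncomputable def recPath (s : ℕ → ℝ) (y0 : ℝ) (n : ℕ) (ξ : Fin n → ℝ) : ℕ → ℝ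
  | 0 => y0
  | k + 1 => s (k + 1) * recPath s y0 n ξ k + (if h : k < n then ξ ⟨k, h⟩ else 0)

theorem recPath_zero (s : ℕ → ℝ) (y0 : ℝ) (n : ℕ) (ξ : Fin n → ℝ) :
    recPath s y0 n ξ 0 = y0 := rfl

theorem recPath_succ (s : ℕ → ℝ) (y0 : ℝ) (n : ℕ) (ξ : Fin n → ℝ) (k : ℕ) :
    recPath s y0 n ξ (k + 1)
      = s (k + 1) * recPath s y0 n ξ k + (if h : k < n then ξ ⟨k, h⟩ else 0) := rfl

/-- Arbitrary coefficient sequences are needed because the likelihood is computed by removing the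
first observation, which shifts the coefficients. -/
theorem arPath_eq_recPath (S : ℝ → ℝ) (y0 : ℝ) (n : ℕ) (ξ : Fin n → ℝ) (k : ℕ) :
    arPath S y0 n ξ k = recPath (fun j => S ((j : ℝ) / n)) y0 n ξ k := by
  induction k with
  | zero => rfl
  | succ k ih => rw [arPath, recPath, ih]

@[fun_prop]
theorem measurable_recPath (s : ℕ → ℝ) (y0 : ℝ) (n k : ℕ) :
    Measurable fun ξ : Fin n → ℝ => recPath s y0 n ξ k := by
  induction k with
  | zero => exact measurable_const
  | succ k ih =>
    simp only [recPath_succ]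
    refine (ih.const_mul _).add ?_
    split_ifs with h
    · exact measurable_pi_apply _
    · exact measurable_const

/-- The vector `(y_1, …, y_n)`. -/
noncomputable def recObs (s : ℕ → ℝ) (y0 : ℝ) (n : ℕ) (ξ : Fin n → ℝ) : Fin n → ℝ :=
  fun i => recPath s y0 n ξ (i + 1)

@[fun_prop]
theorem measurable_recObs (s : ℕ → ℝ) (y0 : ℝ) (n : ℕ) : Measurable (recObs s y0 n) :=
  measurable_pi_lambda _ fun _ => measurable_recPath s y0 n _

/-- The predecessor `y_i` of the observation `y_{i+1}` (of index `i`). -/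
def lag (y0 : ℝ) {n : ℕ} (y : Fin n → ℝ) (i : Fin n) : ℝ :=
  (Fin.cons y0 y : Fin (n + 1) → ℝ) i.castSucc

theorem lag_recObs (s : ℕ → ℝ) (y0 : ℝ) (n : ℕ) (ξ : Fin n → ℝ) (i : Fin n) :
    lag y0 (recObs s y0 n ξ) i = recPath s y0 n ξ i := by
  obtain ⟨i, hi⟩ := i
  cases n with
  | zero => omega
  | succ n =>
    cases i with
    | zero => rfl
    | succ i => rfl

theorem lag_cons_zero (y0 x : ℝ) {n : ℕ} (y : Fin n → ℝ) :
    lag y0 (Fin.cons x y : Fin (n + 1) → ℝ) 0 = y0 := rfl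

theorem lag_cons_succ (y0 x : ℝ) {n : ℕ} (y : Fin n → ℝ) (i : Fin n) :
    lag y0 (Fin.cons x y : Fin (n + 1) → ℝ) i.succ = lag x y i := by
  simp [lag]

@[fun_prop]
theorem measurable_lag (y0 : ℝ) {n : ℕ} (i : Fin n) :
    Measurable fun y : Fin n → ℝ => lag y0 y i := by
  obtain ⟨i, hi⟩ := i
  cases n with
  | zero => omega
  | succ n =>
    cases i with
    | zero => exact measurable_const
    | succ i => exact measurable_pi_apply (⟨i, by omega⟩ : Fin (n + 1))

theorem measurable_lag_uncurry {n : ℕ} (i : Fin n) :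
    Measurable fun p : ℝ × (Fin n → ℝ) => lag p.1 p.2 i := by
  obtain ⟨i, hi⟩ := i
  cases n with
  | zero => omega
  | succ n =>
    cases i with
    | zero => exact measurable_fst
    | succ i => exact (measurable_pi_apply (⟨i, by omega⟩ : Fin (n + 1))).comp measurable_snd

theorem recPath_cons (s : ℕ → ℝ) (y0 x : ℝ) (n : ℕ) (ξ : Fin n → ℝ) (k : ℕ) :
    recPath s y0 (n + 1) (Fin.cons x ξ : Fin (n + 1) → ℝ) (k + 1)
      = recPath (fun j => s (j + 1)) (s 1 * y0 + x) n ξ k := by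
  induction k with
  | zero => simp [recPath]
  | succ k ih =>
    rw [recPath_succ, ih, recPath_succ]
    congr 1
    by_cases h : k < n
    · have h1 : (⟨k + 1, by omega⟩ : Fin (n + 1)) = Fin.succ ⟨k, h⟩ := rfl
      rw [dif_pos (by omega), dif_pos h, h1, Fin.cons_succ]
    · rw [dif_neg (by omega), dif_neg h]

theorem recObs_cons (s : ℕ → ℝ) (y0 x : ℝ) (n : ℕ) (ξ : Fin n → ℝ) :
    recObs s y0 (n + 1) (Fin.cons x ξ : Fin (n + 1) → ℝ)
      = Fin.cons (s 1 * y0 + x) (recObs (fun j => s (j + 1)) (s 1 * y0 + x) n ξ) := by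
  funext i
  refine Fin.cases ?_ (fun i => ?_) i
  · simp [recObs, recPath]
  · simp only [recObs, Fin.cons_succ, Fin.val_succ]
    rw [recPath_cons]

/-- The law of `n` independent standard Gaussian variables. -/
noncomputable def stdGaussianPi (n : ℕ) : Measure (Fin n → ℝ) :=
  Measure.pi fun _ => gaussianReal 0 1

instance (n : ℕ) : IsProbabilityMeasure (stdGaussianPi n) := by
  unfold stdGaussianPi; infer_instance

/-- The one-dimensional Cameron–Martin formula, which supplies one factor of the likelihood per
observation. -/
theorem lintegral_gaussianReal_add (c : ℝ) {F : ℝ → ENNReal} (hF : Measurable F) :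
    ∫⁻ x, F (c + x) ∂gaussianReal 0 1
      = ∫⁻ x, F x * ENNReal.ofReal (Real.exp (c * x - c ^ 2 / 2)) ∂gaussianReal 0 1 := by
  rw [← lintegral_map hF (measurable_const_add c), gaussianReal_map_const_add,
    gaussianReal_of_var_ne_zero _ one_ne_zero, gaussianReal_of_var_ne_zero _ one_ne_zero,
    lintegral_withDensity_eq_lintegral_mul _ (measurable_gaussianPDF _ _) hF,
    lintegral_withDensity_eq_lintegral_mul _ (measurable_gaussianPDF _ _)
      (g := fun x => F x * ENNReal.ofReal (Real.exp (c * x - c ^ 2 / 2))) (hF.mul (by fun_prop))]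
  refine lintegral_congr fun x => ?_
  have h : gaussianPDF (0 + c) 1 x
      = gaussianPDF 0 1 x * ENNReal.ofReal (Real.exp (c * x - c ^ 2 / 2)) := by
    rw [gaussianPDF, gaussianPDF, ← ENNReal.ofReal_mul (gaussianPDFReal_nonneg _ _ _)]
    congr 1
    rw [gaussianPDFReal, gaussianPDFReal, mul_assoc _ (Real.exp _) (Real.exp _), ← Real.exp_add]
    congr 2
    push_cast
    ring
  simp only [Pi.mul_apply, h]
  ring

theorem lintegral_stdGaussianPi_succ (n : ℕ) (F : (Fin (n + 1) → ℝ) → ENNReal)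
    (hF : Measurable F) :
    ∫⁻ ξ, F ξ ∂stdGaussianPi (n + 1)
      = ∫⁻ x, ∫⁻ ξ, F (Fin.cons x ξ) ∂stdGaussianPi n ∂gaussianReal 0 1 := by
  have h := (measurePreserving_piFinSuccAbove (fun _ : Fin (n + 1) => gaussianReal 0 1) 0).symm
  unfold stdGaussianPi
  rw [← h.lintegral_comp hF, lintegral_prod (fun z => F ((MeasurableEquiv.piFinSuccAbove (fun _ => ℝ) 0).symm z))
    (hF.comp h.measurable).aemeasurable]
  refine lintegral_congr fun x => lintegral_congr fun ξ => ?_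
  congr 1
  simp [MeasurableEquiv.piFinSuccAbove]
  rfl

/-- The log-likelihood ratio of the autoregression with coefficients `s` with respect to that
with zero coefficients. -/
noncomputable def arLogLik (s : ℕ → ℝ) (y0 : ℝ) {n : ℕ} (y : Fin n → ℝ) : ℝ :=
  ∑ i : Fin n, (s (i + 1) * lag y0 y i * y i - (s (i + 1) * lag y0 y i) ^ 2 / 2)

theorem arLogLik_cons (s : ℕ → ℝ) (y0 x : ℝ) {n : ℕ} (y : Fin n → ℝ) :
    arLogLik s y0 (Fin.cons x y : Fin (n + 1) → ℝ)
      = (s 1 * y0 * x - (s 1 * y0) ^ 2 / 2) + arLogLik (fun j => s (j + 1)) x y := by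
  rw [arLogLik, Fin.sum_univ_succ]
  simp [lag_cons_zero, lag_cons_succ, arLogLik]

theorem measurable_arLogLik_uncurry (s : ℕ → ℝ) (n : ℕ) :
    Measurable fun p : ℝ × (Fin n → ℝ) => arLogLik s p.1 p.2 := by
  unfold arLogLik
  refine Finset.measurable_sum _ fun i _ => ?_
  have h1 := measurable_lag_uncurry i
  have h2 : Measurable fun p : ℝ × (Fin n → ℝ) => p.2 i :=
    (measurable_pi_apply i).comp measurable_snd
  fun_prop

theorem measurable_arLogLik (s : ℕ → ℝ) (y0 : ℝ) (n : ℕ) :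
    Measurable fun y : Fin n → ℝ => arLogLik s y0 y :=
  (measurable_arLogLik_uncurry s n).comp measurable_prodMk_left

theorem measurable_fin_cons (n : ℕ) :
    Measurable fun p : ℝ × (Fin n → ℝ) => (Fin.cons p.1 p.2 : Fin (n + 1) → ℝ) := by
  refine measurable_pi_lambda _ fun i => ?_
  refine Fin.cases ?_ (fun i => ?_) i
  · exact measurable_fst
  · exact (measurable_pi_apply i).comp measurable_snd

/-- The likelihood ratio formula for Gaussian autoregressions. -/
theorem lintegral_recObs (n : ℕ) : ∀ (s : ℕ → ℝ) (y0 : ℝ) (F : (Fin n → ℝ) → ENNReal),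
    Measurable F →
    ∫⁻ ξ, F (recObs s y0 n ξ) ∂stdGaussianPi n
      = ∫⁻ y, F y * ENNReal.ofReal (Real.exp (arLogLik s y0 y)) ∂stdGaussianPi n := by
  induction n with
  | zero =>
    intro s y0 F _
    refine lintegral_congr fun ξ => ?_
    simp [arLogLik, Subsingleton.elim (recObs s y0 0 ξ) ξ]
  | succ n ih =>
    -- Condition on the first noise variable: the rest is an autoregression of length n started at
    -- s₁y₀ + x, so the induction must range over all starting values. `H` is the inner integral as
    -- a function of that start.
    intro s y0 F hF
    have hFc := hF.comp (measurable_fin_cons n)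
    have hE := (Real.measurable_exp.comp (measurable_arLogLik_uncurry (fun j => s (j + 1)) n))
    set H : ℝ → ENNReal := fun x => ∫⁻ y, F (Fin.cons x y) *
      ENNReal.ofReal (Real.exp (arLogLik (fun j => s (j + 1)) x y)) ∂stdGaussianPi n with hH
    have hHm : Measurable H := Measurable.lintegral_prod_right' (ν := stdGaussianPi n)
      (f := fun p : ℝ × (Fin n → ℝ) => F (Fin.cons p.1 p.2) *
        ENNReal.ofReal (Real.exp (arLogLik (fun j => s (j + 1)) p.1 p.2)))
      (hFc.mul hE.ennreal_ofReal)
    rw [lintegral_stdGaussianPi_succ n (fun ξ => F (recObs s y0 (n + 1) ξ))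
        (hF.comp (measurable_recObs _ _ _)),
      lintegral_stdGaussianPi_succ n
        (fun y => F y * ENNReal.ofReal (Real.exp (arLogLik s y0 y)))
        (hF.mul (Real.measurable_exp.comp (measurable_arLogLik _ _ _)).ennreal_ofReal)]
    calc _ = ∫⁻ x, H (s 1 * y0 + x) ∂gaussianReal 0 1 := by
          refine lintegral_congr fun x => ?_
          simp_rw [recObs_cons]
          exact ih (fun j => s (j + 1)) (s 1 * y0 + x) (fun y => F (Fin.cons (s 1 * y0 + x) y))
            (hFc.comp measurable_prodMk_left)
      _ = _ := by
          rw [lintegral_gaussianReal_add _ hHm]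
          refine lintegral_congr fun x => ?_
          rw [hH, ← lintegral_mul_const' _ _ ENNReal.ofReal_ne_top]
          refine lintegral_congr fun y => ?_
          rw [arLogLik_cons, Real.exp_add, ENNReal.ofReal_mul (Real.exp_pos _).le]
          ring

/-! ### Moments and concentration under Gaussian noise -/

theorem measurePreserving_eval_stdGaussianPi {n : ℕ} (i : Fin n) :
    MeasurePreserving (fun ξ : Fin n → ℝ => ξ i) (stdGaussianPi n) (gaussianReal 0 1) :=
  measurePreserving_eval (fun _ : Fin n => gaussianReal 0 1) i

theorem memLp_eval_stdGaussianPi {n : ℕ} (i : Fin n) :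
    MemLp (fun ξ : Fin n → ℝ => ξ i) 2 (stdGaussianPi n) :=
  (memLp_id_gaussianReal' 2 (by simp)).comp_measurePreserving
    (measurePreserving_eval_stdGaussianPi i)

theorem integral_sq_gaussianReal : ∫ x, x ^ 2 ∂gaussianReal 0 1 = 1 := by
  have h := variance_fun_id_gaussianReal (μ := 0) (v := 1)
  rw [variance_eq_integral aemeasurable_id'] at h
  simpa [integral_id_gaussianReal] using h

theorem integral_eval_sq_stdGaussianPi {n : ℕ} (i : Fin n) :
    ∫ ξ, (ξ i) ^ 2 ∂stdGaussianPi n = 1 := by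
  have h := measurePreserving_eval_stdGaussianPi i
  rw [← integral_sq_gaussianReal, ← h.map_eq, integral_map h.measurable.aemeasurable]
  exact (measurable_id.pow_const 2).aestronglyMeasurable

theorem memLp_recPath (s : ℕ → ℝ) (y0 : ℝ) (n k : ℕ) :
    MemLp (fun ξ : Fin n → ℝ => recPath s y0 n ξ k) 2 (stdGaussianPi n) := by
  induction k with
  | zero => exact memLp_const _
  | succ k ih =>
    simp only [recPath_succ]
    refine (ih.const_mul _).add ?_
    split_ifs with h
    · exact memLp_eval_stdGaussianPi _
    · exact memLp_const _

/-- With |s| ≤ 1/2, (s y + ξ)² ≤ y²/2 + 2ξ², so the second moment M evolves by at most M/2 + 2,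
whose fixed point is 4. -/
theorem integral_recPath_sq_le {s : ℕ → ℝ} {r : ℝ} (hr : r ≤ 1 / 2) (hs : ∀ k, |s k| ≤ r)
    (y0 : ℝ) (n k : ℕ) :
    ∫ ξ, (recPath s y0 n ξ k) ^ 2 ∂stdGaussianPi n ≤ 4 + y0 ^ 2 := by
  induction k with
  | zero => simp [recPath_zero]
  | succ k ih =>
    set f : (Fin n → ℝ) → ℝ := fun ξ => if h : k < n then ξ ⟨k, h⟩ else 0 with hf
    have hfi : Integrable (fun ξ => f ξ ^ 2) (stdGaussianPi n) ∧
        ∫ ξ, f ξ ^ 2 ∂stdGaussianPi n ≤ 1 := by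
      by_cases h : k < n
      · simp only [hf, dif_pos h]
        exact ⟨(memLp_eval_stdGaussianPi _).integrable_sq,
          (integral_eval_sq_stdGaussianPi _).le⟩
      · simp [hf, dif_neg h]
    have hy := (memLp_recPath s y0 n k).integrable_sq
    have hsq : s (k + 1) ^ 2 ≤ 1 / 4 := by
      have := (hs (k + 1)).trans hr
      rw [← sq_abs]
      nlinarith [abs_nonneg (s (k + 1))]
    calc ∫ ξ, (recPath s y0 n ξ (k + 1)) ^ 2 ∂stdGaussianPi n
        ≤ ∫ ξ, (1 / 2 * (recPath s y0 n ξ k) ^ 2 + 2 * f ξ ^ 2) ∂stdGaussianPi n := by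
          refine integral_mono (memLp_recPath s y0 n (k + 1)).integrable_sq
            ((hy.const_mul _).add (hfi.1.const_mul _)) fun ξ => ?_
          simp only [recPath_succ]
          change (s (k + 1) * recPath s y0 n ξ k + f ξ) ^ 2 ≤ _
          nlinarith [sq_nonneg (s (k + 1) * recPath s y0 n ξ k - f ξ),
            mul_le_mul_of_nonneg_right hsq (sq_nonneg (recPath s y0 n ξ k))]
      _ = 1 / 2 * ∫ ξ, (recPath s y0 n ξ k) ^ 2 ∂stdGaussianPi n
            + 2 * ∫ ξ, f ξ ^ 2 ∂stdGaussianPi n := by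
          rw [integral_add (hy.const_mul _) (hfi.1.const_mul _), integral_const_mul,
            integral_const_mul]
      _ ≤ 4 + y0 ^ 2 := by nlinarith [hfi.2, sq_nonneg y0]

/-- The variance of the square of a standard Gaussian variable. -/
noncomputable def gaussianSqVar : ℝ := Var[fun x => x ^ 2 - 1; gaussianReal 0 1]

theorem gaussianSqVar_nonneg : 0 ≤ gaussianSqVar := variance_nonneg _ _

theorem memLp_sq_sub_one_gaussianReal :
    MemLp (fun x : ℝ => x ^ 2 - 1) 2 (gaussianReal 0 1) := by
  refine MemLp.sub ?_ (memLp_const _)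
  have h : MemLp (id : ℝ → ℝ) 4 (gaussianReal 0 1) := memLp_id_gaussianReal' 4 (by simp)
  have := h.norm_rpow_div (q := 2)
  simp only [id_eq, Real.norm_eq_abs, ENNReal.toReal_ofNat] at this
  norm_num at this
  have e : (4 : ENNReal) / 2 = 2 := by
    rw [show (4 : ENNReal) = 2 * 2 by norm_num, mul_div_assoc,
      ENNReal.div_self (by simp) (by simp), mul_one]
  rwa [e] at this

theorem integral_sq_sum_sq_sub_one {n : ℕ} (u : Fin n → ℝ) :
    Integrable (fun ξ => (∑ i, u i * (ξ i ^ 2 - 1)) ^ 2) (stdGaussianPi n) ∧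
    ∫ ξ, (∑ i, u i * (ξ i ^ 2 - 1)) ^ 2 ∂stdGaussianPi n = gaussianSqVar * ∑ i, u i ^ 2 := by
  set X : Fin n → (Fin n → ℝ) → ℝ := fun i ξ => u i * (ξ i ^ 2 - 1) with hX
  have hmem : ∀ i, MemLp (X i) 2 (stdGaussianPi n) := fun i =>
    (memLp_sq_sub_one_gaussianReal.comp_measurePreserving
      (measurePreserving_eval_stdGaussianPi i)).const_mul _
  have hind : iIndepFun X (stdGaussianPi n) :=
    iIndepFun_pi (X := fun (i : Fin n) (x : ℝ) => u i * (x ^ 2 - 1))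
      fun i => (by fun_prop : Measurable fun x : ℝ => u i * (x ^ 2 - 1)).aemeasurable
  have hvar := IndepFun.variance_sum (X := X) (s := Finset.univ) (μ := stdGaussianPi n)
    (fun i _ => hmem i) (fun i _ j _ hij => hind.indepFun hij)
  have hvi : ∀ i, variance (X i) (stdGaussianPi n) = u i ^ 2 * gaussianSqVar := by
    intro i
    rw [hX, variance_const_mul, gaussianSqVar]
    congr 1
    exact (measurePreserving_eval_stdGaussianPi i).variance_fun_comp
      (f := fun x : ℝ => x ^ 2 - 1) (by fun_prop)
  have hmean : ∫ ξ, (∑ i, X i) ξ ∂stdGaussianPi n = 0 := by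
    simp only [Finset.sum_apply]
    rw [integral_finsetSum _ fun i _ => (hmem i).integrable (by norm_num)]
    refine Finset.sum_eq_zero fun i _ => ?_
    rw [hX, integral_const_mul, integral_sub (memLp_eval_stdGaussianPi i).integrable_sq
      (integrable_const _), integral_eval_sq_stdGaussianPi]
    simp
  have hsum : MemLp (∑ i, X i) 2 (stdGaussianPi n) := memLp_finsetSum' _ fun i _ => hmem i
  refine ⟨by simpa [Finset.sum_apply] using hsum.integrable_sq, ?_⟩
  rw [variance_of_integral_eq_zero hsum.aemeasurable hmean] at hvar
  simp only [Finset.sum_apply, hvi] at hvar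
  rw [hvar, ← Finset.sum_mul, mul_comm]

/-- The three terms bound the deterministic start, the independent centred sum obtained by replacing
each y by its innovation, and the error of that replacement. The constant 9 + 2y₀² is 2(4 + y₀²) +
1. -/
theorem integral_abs_sum_recPath_sq_sub_one_le {m : ℕ} {s : ℕ → ℝ} {r : ℝ} (hr0 : 0 ≤ r)
    (hr : r ≤ 1 / 2) (hs : ∀ k, |s k| ≤ r) (y0 : ℝ) {v : Fin (m + 1) → ℝ} (hv0 : ∀ i, 0 ≤ v i)
    (hv1 : ∀ i, v i ≤ 1) {κ : ℝ} (hκ : 0 < κ) :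
    ∫ ξ, |∑ i, v i * (recPath s y0 (m + 1) ξ i ^ 2 - 1)| ∂stdGaussianPi (m + 1)
      ≤ (1 + y0 ^ 2) + (κ + gaussianSqVar * (∑ i, v i) / κ)
        + r * (9 + 2 * y0 ^ 2) * ∑ i, v i := by
  set μ := stdGaussianPi (m + 1)
  set y : ℕ → (Fin (m + 1) → ℝ) → ℝ := fun k ξ => recPath s y0 (m + 1) ξ k with hy
  -- The innovation of y_{j+1} is the noise coordinate j, so the weights shift by one. The last
  -- coordinate enters no lagged value and gets weight 0.
  set u : Fin (m + 1) → ℝ := Fin.snoc (fun j : Fin m => v j.succ) 0 with hu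
  set Z : (Fin (m + 1) → ℝ) → ℝ := fun ξ => ∑ i, u i * (ξ i ^ 2 - 1) with hZ
  have hZ' : ∀ ξ, Z ξ = ∑ j : Fin m, v j.succ * (ξ j.castSucc ^ 2 - 1) := fun ξ => by
    simp [hZ, hu, Fin.sum_univ_castSucc]
  have hvsum : ∑ j : Fin m, v j.succ ≤ ∑ i, v i := by
    rw [Fin.sum_univ_succ v]; linarith [hv0 0]
  have hZsq := integral_sq_sum_sq_sub_one u
  have husq : ∑ i, u i ^ 2 ≤ ∑ i, v i := by
    refine le_trans ?_ hvsum
    rw [Fin.sum_univ_castSucc]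
    simp only [hu, Fin.snoc_castSucc, Fin.snoc_last]
    rw [zero_pow two_ne_zero, add_zero]
    exact Finset.sum_le_sum fun j _ => by nlinarith [hv0 j.succ, hv1 j.succ]
  have hyint : ∀ k, Integrable (fun ξ => y k ξ ^ 2) μ := fun k =>
    (memLp_recPath s y0 (m + 1) k).integrable_sq
  have hxint : ∀ j : Fin m, Integrable (fun ξ : Fin (m + 1) → ℝ => ξ j.castSucc ^ 2) μ :=
    fun j => (memLp_eval_stdGaussianPi j.castSucc).integrable_sq
  have hrec : ∀ (j : Fin m) ξ, y (j + 1) ξ = s (j + 1) * y j ξ + ξ j.castSucc := by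
    intro j ξ
    simp only [hy, recPath_succ]
    rw [dif_pos (show (j : ℕ) < m + 1 by omega)]
    rfl
  have hpt : ∀ ξ, |∑ i : Fin (m + 1), v i * (y i ξ ^ 2 - 1)|
      ≤ (1 + y0 ^ 2) + (κ + Z ξ ^ 2 / κ)
        + ∑ j : Fin m, v j.succ * r * (2 * y j ξ ^ 2 + ξ j.castSucc ^ 2) := by
    intro ξ
    have h0 : |v 0 * (y 0 ξ ^ 2 - 1)| ≤ 1 + y0 ^ 2 := by
      rw [abs_mul, abs_of_nonneg (hv0 0)]
      have h1 : |y 0 ξ ^ 2 - 1| ≤ 1 + y0 ^ 2 := by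
        change |y0 ^ 2 - 1| ≤ _
        rw [abs_le]; constructor <;> nlinarith [sq_nonneg y0]
      exact (mul_le_of_le_one_left (abs_nonneg _) (hv1 0)).trans h1
    have hZb : |Z ξ| ≤ κ + Z ξ ^ 2 / κ := by
      rw [← sub_nonneg]
      have : κ + Z ξ ^ 2 / κ - |Z ξ| = ((|Z ξ| - κ) ^ 2 + κ * |Z ξ|) / κ := by
        rw [← sq_abs (Z ξ)]; field_simp; ring
      rw [this]; positivity
    have hterm : ∀ j : Fin m, |v j.succ * (y (j + 1) ξ ^ 2 - 1)
        - v j.succ * (ξ j.castSucc ^ 2 - 1)|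
        ≤ v j.succ * r * (2 * y j ξ ^ 2 + ξ j.castSucc ^ 2) := by
      intro j
      rw [hrec, ← mul_sub, abs_mul, abs_of_nonneg (hv0 _), mul_assoc]
      refine mul_le_mul_of_nonneg_left ?_ (hv0 _)
      have hsb := hs (j + 1)
      set a := s (j + 1)
      set b := y j ξ
      set x := ξ j.castSucc
      have e : (a * b + x) ^ 2 - 1 - (x ^ 2 - 1) = a * (a * b ^ 2 + 2 * b * x) := by ring
      rw [e, abs_mul]
      have ha1 : |a| ≤ 1 := by linarith
      have h2 : |a * b ^ 2 + 2 * b * x| ≤ 2 * b ^ 2 + x ^ 2 := by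
        have := abs_le.mp ha1
        rw [abs_le]
        constructor <;> nlinarith [sq_nonneg (b + x), sq_nonneg (b - x), sq_nonneg b]
      exact mul_le_mul hsb h2 (abs_nonneg _) hr0
    rw [Fin.sum_univ_succ]
    have hsplit : ∑ j : Fin m, v j.succ * (y (j.succ : Fin (m + 1)) ξ ^ 2 - 1)
        = Z ξ + ∑ j : Fin m, (v j.succ * (y (j + 1) ξ ^ 2 - 1)
          - v j.succ * (ξ j.castSucc ^ 2 - 1)) := by
      rw [hZ', ← Finset.sum_add_distrib]
      exact Finset.sum_congr rfl fun j _ => by rw [Fin.val_succ]; ring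
    rw [hsplit]
    refine (abs_add_le _ _).trans ?_
    rw [add_assoc (1 + y0 ^ 2)]
    refine add_le_add h0 ((abs_add_le _ _).trans (add_le_add hZb ?_))
    exact (Finset.abs_sum_le_sum_abs _ _).trans (Finset.sum_le_sum fun j _ => hterm j)
  have hi1 : Integrable (fun ξ => κ + Z ξ ^ 2 / κ) μ :=
    (integrable_const _).add (hZsq.1.div_const _)
  have hi2 : ∀ j : Fin m, Integrable
      (fun ξ => v j.succ * r * (2 * y j ξ ^ 2 + ξ j.castSucc ^ 2)) μ := fun j =>
    (((hyint j).const_mul 2).add (hxint j)).const_mul _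
  have hi3 := integrable_finsetSum Finset.univ fun j _ => hi2 j
  have hi4 : Integrable (fun ξ => ∑ i : Fin (m + 1), v i * (y i ξ ^ 2 - 1)) μ :=
    integrable_finsetSum _ fun i _ => ((hyint i).sub (integrable_const _)).const_mul _
  calc ∫ ξ, |∑ i : Fin (m + 1), v i * (y i ξ ^ 2 - 1)| ∂μ
      ≤ ∫ ξ, ((1 + y0 ^ 2) + (κ + Z ξ ^ 2 / κ)
        + ∑ j : Fin m, v j.succ * r * (2 * y j ξ ^ 2 + ξ j.castSucc ^ 2)) ∂μ :=
        integral_mono hi4.abs (((integrable_const _).add hi1).add hi3) hpt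
    _ = (1 + y0 ^ 2) + (κ + (∫ ξ, Z ξ ^ 2 ∂μ) / κ)
        + ∑ j : Fin m, v j.succ * r *
          (2 * ∫ ξ, y j ξ ^ 2 ∂μ + ∫ ξ : Fin (m + 1) → ℝ, ξ j.castSucc ^ 2 ∂μ) := by
        rw [integral_add (f := fun ξ => (1 + y0 ^ 2) + (κ + Z ξ ^ 2 / κ))
            ((integrable_const _).add hi1) hi3, integral_add (integrable_const _) hi1,
          integral_add (integrable_const _) (hZsq.1.div_const _), integral_div,
          integral_finsetSum _ fun j _ => hi2 j]
        congr 1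
        · simp
          rfl
        · refine Finset.sum_congr rfl fun j _ => ?_
          rw [integral_const_mul, integral_add ((hyint j).const_mul 2) (hxint j),
            integral_const_mul]
    _ ≤ (1 + y0 ^ 2) + (κ + gaussianSqVar * (∑ i, v i) / κ)
        + ∑ j : Fin m, v j.succ * r * (9 + 2 * y0 ^ 2) := by
        refine add_le_add (add_le_add le_rfl (add_le_add le_rfl
          (div_le_div_of_nonneg_right ?_ hκ.le))) ?_
        · rw [hZsq.2]
          exact mul_le_mul_of_nonneg_left husq gaussianSqVar_nonneg
        · refine Finset.sum_le_sum fun j _ => ?_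
          refine mul_le_mul_of_nonneg_left ?_ (mul_nonneg (hv0 _) hr0)
          have h1 := integral_recPath_sq_le hr hs y0 (m + 1) j
          have h2 := integral_eval_sq_stdGaussianPi j.castSucc
          rw [h2]
          linarith
    _ ≤ _ := by
        gcongr
        rw [← Finset.sum_mul, ← Finset.sum_mul, mul_comm, mul_comm _ r, ← mul_assoc,
          mul_comm _ r]
        exact mul_le_mul_of_nonneg_left hvsum (by positivity)

/-! ### Score, information and the parametric lower bound -/

/-- The score at `0` of the family of autoregressions with coefficients `(u / ρ) w`. -/
noncomputable def arScore (w : ℕ → ℝ) (ρ y0 : ℝ) {n : ℕ} (y : Fin n → ℝ) : ℝ :=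
  (∑ i : Fin n, w (i + 1) * lag y0 y i * y i) / ρ

/-- The observed information of the family of autoregressions with coefficients `(u / ρ) w`. -/
noncomputable def arInfo (w : ℕ → ℝ) (ρ y0 : ℝ) {n : ℕ} (y : Fin n → ℝ) : ℝ :=
  (∑ i : Fin n, w (i + 1) ^ 2 * lag y0 y i ^ 2) / ρ ^ 2

theorem measurable_arScore (w : ℕ → ℝ) (ρ y0 : ℝ) (n : ℕ) :
    Measurable fun y : Fin n → ℝ => arScore w ρ y0 y := by
  unfold arScore; fun_prop

theorem measurable_arInfo (w : ℕ → ℝ) (ρ y0 : ℝ) (n : ℕ) :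
    Measurable fun y : Fin n → ℝ => arInfo w ρ y0 y := by
  unfold arInfo; fun_prop

theorem exp_arLogLik (w : ℕ → ℝ) (ρ y0 u : ℝ) {n : ℕ} (y : Fin n → ℝ) :
    Real.exp (arLogLik (fun k => u / ρ * w k) y0 y)
      = quadLik u (arScore w ρ y0 y) (arInfo w ρ y0 y) := by
  rw [quadLik, arScore, arInfo, arLogLik, Finset.sum_div, Finset.sum_div, Finset.mul_sum,
    Finset.mul_sum, Finset.sum_div, ← Finset.sum_sub_distrib]
  congr 1
  exact Finset.sum_congr rfl fun i _ => by ring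

theorem lintegral_recObs_local (w : ℕ → ℝ) (ρ y0 u : ℝ) {n : ℕ} {F : (Fin n → ℝ) → ENNReal}
    (hF : Measurable F) :
    ∫⁻ ξ, F (recObs (fun k => u / ρ * w k) y0 n ξ) ∂stdGaussianPi n
      = ∫⁻ y, F y * ENNReal.ofReal (quadLik u (arScore w ρ y0 y) (arInfo w ρ y0 y))
          ∂stdGaussianPi n := by
  rw [lintegral_recObs n _ y0 F hF]
  simp_rw [exp_arLogLik]

/-- Concentration of the observed information. -/
theorem measure_arInfo_not_mem_le {m : ℕ} {w : ℕ → ℝ} (hw0 : ∀ k, 0 ≤ w k) (hw1 : ∀ k, w k ≤ 1)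
    {ρ b lo hi δ η u : ℝ} (y0 : ℝ) (hρ : 0 < ρ) (hb : b / ρ ≤ 1 / 2) (hδ : 0 < δ)
    (hlo : lo + δ ≤ (∑ i : Fin (m + 1), w (i + 1) ^ 2) / ρ ^ 2)
    (hhi : (∑ i : Fin (m + 1), w (i + 1) ^ 2) / ρ ^ 2 ≤ hi - δ)
    (hη : (1 + y0 ^ 2) + (ρ + gaussianSqVar * (∑ i : Fin (m + 1), w (i + 1) ^ 2) / ρ)
      + b / ρ * (9 + 2 * y0 ^ 2) * (∑ i : Fin (m + 1), w (i + 1) ^ 2) ≤ δ * η * ρ ^ 2)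
    (hu : |u| ≤ b) :
    stdGaussianPi (m + 1) {ξ | ¬(lo ≤ arInfo w ρ y0 (recObs (fun k => u / ρ * w k) y0 (m + 1) ξ) ∧
      arInfo w ρ y0 (recObs (fun k => u / ρ * w k) y0 (m + 1) ξ) ≤ hi)} ≤ ENNReal.ofReal η := by
  set s : ℕ → ℝ := fun k => u / ρ * w k
  set N := ∑ i : Fin (m + 1), w (i + 1) ^ 2 with hN
  have hb0 : 0 ≤ b := (abs_nonneg u).trans hu
  have hs : ∀ k, |s k| ≤ b / ρ := by
    intro k
    change |u / ρ * w k| ≤ _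
    rw [abs_mul, abs_div, abs_of_pos hρ, abs_of_nonneg (hw0 k)]
    exact (mul_le_of_le_one_right (by positivity) (hw1 k)).trans
      (div_le_div_of_nonneg_right hu hρ.le)
  set f : (Fin (m + 1) → ℝ) → ℝ := fun ξ =>
    |∑ i : Fin (m + 1), w (i + 1) ^ 2 * (recPath s y0 (m + 1) ξ i ^ 2 - 1)| with hf
  -- The free parameter κ is taken to be ρ, which balances κ against (∑ v)/κ when ∑ v is of order
  -- ρ². Markov's inequality then bounds the deviation probability.
  have hbound := integral_abs_sum_recPath_sq_sub_one_le (m := m) (div_nonneg hb0 hρ.le) hb hs y0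
    (v := fun i => w (i + 1) ^ 2) (fun i => sq_nonneg _)
    (fun i => pow_le_one₀ (hw0 _) (hw1 _)) hρ
  have hfint : Integrable f (stdGaussianPi (m + 1)) :=
    Integrable.abs (f := fun ξ => ∑ i : Fin (m + 1),
      w (i + 1) ^ 2 * (recPath s y0 (m + 1) ξ i ^ 2 - 1)) <| integrable_finsetSum _ fun i _ =>
        ((memLp_recPath s y0 (m + 1) i).integrable_sq.sub (integrable_const _)).const_mul _
  have hmarkov := mul_meas_ge_le_integral_of_nonneg (ae_of_all _ fun ξ => abs_nonneg _) hfint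
    (δ * ρ ^ 2)
  have hreal : (stdGaussianPi (m + 1)).real {ξ | δ * ρ ^ 2 ≤ f ξ} ≤ η := by
    have h1 := (hmarkov.trans hbound).trans hη
    have h2 : 0 < δ * ρ ^ 2 := by positivity
    rw [show δ * η * ρ ^ 2 = δ * ρ ^ 2 * η by ring] at h1
    exact le_of_mul_le_mul_left h1 h2
  refine le_trans (measure_mono ?_) (ENNReal.le_ofReal_iff_toReal_le (measure_ne_top _ _)
    (measureReal_nonneg.trans hreal) |>.mpr hreal)
  intro ξ hξ
  by_contra hcon
  apply hξ
  have hlt : f ξ < δ * ρ ^ 2 := not_le.mp hcon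
  have hinfo : arInfo w ρ y0 (recObs s y0 (m + 1) ξ) = N / ρ ^ 2 +
      (∑ i : Fin (m + 1), w (i + 1) ^ 2 * (recPath s y0 (m + 1) ξ i ^ 2 - 1)) / ρ ^ 2 := by
    rw [arInfo, ← add_div, hN, ← Finset.sum_add_distrib]
    congr 1
    exact Finset.sum_congr rfl fun i _ => by rw [lag_recObs]; ring
  have habs := abs_lt.mp hlt
  have hρ2 : 0 < ρ ^ 2 := by positivity
  have h1 : -δ < (∑ i : Fin (m + 1), w (i + 1) ^ 2 * (recPath s y0 (m + 1) ξ i ^ 2 - 1)) / ρ ^ 2 := by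
    rw [lt_div_iff₀ hρ2]; linarith [habs.1]
  have h2 : (∑ i : Fin (m + 1), w (i + 1) ^ 2 * (recPath s y0 (m + 1) ξ i ^ 2 - 1)) / ρ ^ 2 < δ := by
    rw [div_lt_iff₀ hρ2]; exact habs.2
  rw [hinfo]
  constructor <;> linarith

/-- Lower bound of the worst-case risk over a one-parameter family of autoregressions. -/
theorem le_of_forall_lintegral_recObs_le {m : ℕ} {w : ℕ → ℝ} (hw0 : ∀ k, 0 ≤ w k)
    (hw1 : ∀ k, w k ≤ 1) {ρ a b lo hi δ η : ℝ} (y0 : ℝ) (hρ : 0 < ρ) (ha : 0 < a)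
    (hab : 2 * a < b) (hlo0 : 0 < lo) (hlohi : lo ≤ hi) (hη0 : 0 ≤ η) (hb : b / ρ ≤ 1 / 2)
    (hδ : 0 < δ) (hlo : lo + δ ≤ (∑ i : Fin (m + 1), w (i + 1) ^ 2) / ρ ^ 2)
    (hhi : (∑ i : Fin (m + 1), w (i + 1) ^ 2) / ρ ^ 2 ≤ hi - δ)
    (hη : (1 + y0 ^ 2) + (ρ + gaussianSqVar * (∑ i : Fin (m + 1), w (i + 1) ^ 2) / ρ)
      + b / ρ * (9 + 2 * y0 ^ 2) * (∑ i : Fin (m + 1), w (i + 1) ^ 2) ≤ δ * η * ρ ^ 2)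
    {T : (Fin (m + 1) → ℝ) → ℝ} (hT : Measurable T) {R : ENNReal}
    (hR : ∀ u, |u| ≤ b → ∫⁻ ξ, ENNReal.ofReal
      |T (recObs (fun k => u / ρ * w k) y0 (m + 1) ξ) - u| ∂stdGaussianPi (m + 1) ≤ R) :
    ENNReal.ofReal ((b - 2 * a) / b *
        (√(lo / (2 * Real.pi)) * (2 / hi * (1 - Real.exp (-(hi * a ^ 2 / 2))))) *
        (1 - η - 2 * Real.exp (-(lo * a ^ 2 / 2)))) ≤ R := by
  have hI := measurable_arInfo w ρ y0 (m + 1)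
  refine le_of_forall_lintegral_quadLik_le (P := stdGaussianPi (m + 1))
    (measurable_arScore w ρ y0 (m + 1)) hI hT ?_ ha hab hlo0 hlohi hη0 ?_ ?_
  · intro u
    have h := lintegral_recObs_local w ρ y0 u (n := m + 1) (F := fun _ => 1) measurable_const
    simpa using h.symm
  · intro u hu
    have hset : MeasurableSet {y : Fin (m + 1) → ℝ |
        ¬(lo ≤ arInfo w ρ y0 y ∧ arInfo w ρ y0 y ≤ hi)} :=
      ((measurableSet_le measurable_const hI).inter
        (measurableSet_le hI measurable_const)).compl
    have h := lintegral_recObs_local w ρ y0 u (n := m + 1)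
      (F := indicator {y | ¬(lo ≤ arInfo w ρ y0 y ∧ arInfo w ρ y0 y ≤ hi)} 1)
      (measurable_one.indicator hset)
    have h2 := measure_arInfo_not_mem_le hw0 hw1 y0 hρ hb hδ hlo hhi hη hu
    rw [← lintegral_indicator hset]
    refine le_trans (le_of_eq ?_) h2
    refine Eq.trans (lintegral_congr fun y => ?_) (h.symm.trans (lintegral_indicator_one
      (hset.preimage (measurable_recObs (fun k => u / ρ * w k) y0 (m + 1)))))
    by_cases hy : y ∈ {y | ¬(lo ≤ arInfo w ρ y0 y ∧ arInfo w ρ y0 y ≤ hi)}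
    · rw [indicator_of_mem hy, indicator_of_mem hy]; simp
    · rw [indicator_of_notMem hy, indicator_of_notMem hy]; simp
  · intro u hu
    have h := lintegral_recObs_local w ρ y0 u (n := m + 1)
      (F := fun y => ENNReal.ofReal |T y - u|) (hT.sub_const u).abs.ennreal_ofReal
    rw [← h]
    exact hR u hu

/-! ### The Gaussian density as admissible noise, and the limiting constant -/

theorem integral_even_moment_gaussianPDFReal (k : ℕ) :
    ∫ x, |x| ^ (2 * k) * gaussianPDFReal 0 1 x = ((2 * k - 1)‼ : ℝ) := by
  have h1 : ∀ x : ℝ, |x| ^ (2 * k) * gaussianPDFReal 0 1 x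
      = (fun t : ℝ => (√(2 * Real.pi))⁻¹ * (t ^ (2 * k) * Real.exp (-(1 / 2) * t ^ 2))) |x| := by
    intro x
    simp only [gaussianPDFReal, sq_abs]
    push_cast
    rw [mul_one, sub_zero, mul_one, show -x ^ 2 / 2 = -(1 / 2) * x ^ 2 by ring]
    ring
  have h2 : ∫ x in Ioi (0 : ℝ), x ^ (2 * k) * Real.exp (-(1 / 2) * x ^ 2)
      = (1 / 2 : ℝ) ^ (-((2 * k : ℕ) + 1 : ℝ) / 2) * (1 / 2) *
        Real.Gamma (((2 * k : ℕ) + 1 : ℝ) / 2) := by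
    rw [← integral_rpow_mul_exp_neg_mul_rpow (p := 2) (q := ((2 * k : ℕ) : ℝ)) (b := 1 / 2)
      (by norm_num) (by linarith [Nat.cast_nonneg (α := ℝ) (2 * k)]) (by norm_num)]
    simp only [Real.rpow_natCast, Real.rpow_two]
  simp_rw [h1]
  rw [integral_comp_abs (f := fun t : ℝ =>
    (√(2 * Real.pi))⁻¹ * (t ^ (2 * k) * Real.exp (-(1 / 2) * t ^ 2))), integral_const_mul, h2]
  have h3 : (((2 * k : ℕ) + 1 : ℝ) / 2) = (k : ℝ) + 1 / 2 := by push_cast; ring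
  have h4 : (1 / 2 : ℝ) ^ (-((2 * k : ℕ) + 1 : ℝ) / 2) = 2 ^ k * √2 := by
    rw [neg_div, h3, one_div, Real.inv_rpow (by norm_num), Real.rpow_neg (by norm_num), inv_inv,
      Real.rpow_add (by norm_num), Real.rpow_natCast, ← one_div, ← Real.sqrt_eq_rpow]
  rw [h4, h3, Real.Gamma_nat_add_half, Real.sqrt_mul (by norm_num)]
  have hpi : √Real.pi ≠ 0 := by positivity
  have h2' : √(2 : ℝ) ≠ 0 := by positivity
  field_simp

theorem isNoiseDensity_gaussianPDFReal {ς : ℝ} (hς : 1 ≤ ς) :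
    IsNoiseDensity ς (gaussianPDFReal 0 1) := by
  have hpos : ∀ k : ℕ, (0 : ℝ) < ((2 * k - 1)‼ : ℝ) := fun k => by
    exact_mod_cast Nat.doubleFactorial_pos _
  refine ⟨measurable_gaussianPDFReal 0 1, gaussianPDFReal_nonneg 0 1,
    integral_gaussianPDFReal_eq_one 0 one_ne_zero, ?_, ?_, fun k _ => ?_, fun k _ => ?_⟩
  · have h := integral_gaussianReal_eq_integral_smul (μ := 0) (v := 1) (f := fun x : ℝ => x)
      one_ne_zero
    rw [integral_id_gaussianReal] at h
    simpa [mul_comm] using h.symm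
  · simpa using integral_even_moment_gaussianPDFReal 1
  -- A non-integrable function has integral 0 by convention, whereas this moment is positive.
  · by_contra hcon
    have := integral_even_moment_gaussianPDFReal k
    rw [integral_undef hcon] at this
    exact (hpos k).ne this
  · rw [integral_even_moment_gaussianPDFReal, one_div, mul_inv, mul_assoc,
      inv_mul_cancel₀ (hpos k).ne', mul_one]
    exact inv_le_one_of_one_le₀ (one_le_pow₀ hς)

theorem noiseLaw_gaussianPDFReal : noiseLaw (gaussianPDFReal 0 1) = gaussianReal 0 1 := by
  rw [gaussianReal_of_var_ne_zero _ one_ne_zero]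
  rfl

theorem lintegral_obsLaw_gaussianPDFReal (S : ℝ → ℝ) (y0 : ℝ) (n : ℕ)
    {F : (Fin n → ℝ) → ENNReal} (hF : Measurable F) :
    ∫⁻ y, F y ∂obsLaw S (gaussianPDFReal 0 1) y0 n
      = ∫⁻ ξ, F (recObs (fun k => S ((k : ℝ) / n)) y0 n ξ) ∂stdGaussianPi n := by
  rw [obsLaw, lintegral_map hF (measurable_arObs S y0 n), noiseLaw_gaussianPDFReal]
  have h : arObs S y0 n = recObs (fun k => S ((k : ℝ) / n)) y0 n := by
    funext ξ i
    exact arPath_eq_recPath S y0 n ξ (i + 1)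
  rw [h]
  rfl

theorem lintegral_abs_gaussianReal_half :
    ∫⁻ x, ENNReal.ofReal |x| ∂gaussianReal 0 (1 / 2) = ENNReal.ofReal (√Real.pi)⁻¹ := by
  have hv : (1 / 2 : NNReal) ≠ 0 := by norm_num
  rw [gaussianReal_of_var_ne_zero _ hv, lintegral_withDensity_eq_lintegral_mul _
    (measurable_gaussianPDF _ _) (by fun_prop)]
  have h1 : ∀ x : ℝ, (gaussianPDF 0 (1 / 2) * fun x => ENNReal.ofReal |x|) x
      = ENNReal.ofReal ((fun t : ℝ => (√Real.pi)⁻¹ * (t * Real.exp (-1 * t ^ 2))) |x|) := by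
    intro x
    rw [Pi.mul_apply, gaussianPDF, ← ENNReal.ofReal_mul (gaussianPDFReal_nonneg _ _ _)]
    congr 1
    simp only [gaussianPDFReal, sq_abs]
    push_cast
    rw [show 2 * Real.pi * (1 / 2) = Real.pi by ring, sub_zero,
      show -x ^ 2 / (2 * (1 / 2)) = -1 * x ^ 2 by ring]
    ring
  have h2 : ∫ x in Ioi (0 : ℝ), x * Real.exp (-1 * x ^ 2) = 1 / 2 := by
    have h := integral_rpow_mul_exp_neg_mul_rpow (p := 2) (q := 1) (b := 1)
      (by norm_num) (by norm_num) (by norm_num)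
    simp only [Real.rpow_one, Real.rpow_two] at h
    rw [h]
    norm_num
  have h3 : ∫ x : ℝ, (fun t : ℝ => (√Real.pi)⁻¹ * (t * Real.exp (-1 * t ^ 2))) |x|
      = (√Real.pi)⁻¹ := by
    refine (integral_comp_abs (f := fun t : ℝ => (√Real.pi)⁻¹ * (t * Real.exp (-1 * t ^ 2)))).trans ?_
    rw [integral_const_mul, h2]
    ring
  simp_rw [h1]
  rw [← ofReal_integral_eq_lintegral_ofReal, h3]
  · by_contra hcon
    rw [integral_undef hcon] at h3
    have : 0 < (√Real.pi)⁻¹ := by positivity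
    exact this.ne h3
  · exact ae_of_all _ fun x => by positivity

/-! ### The least favourable curves -/

/-- A smooth function equal to `1` on `[-1, 1]` and supported in `[-(1 + δ), 1 + δ]`. -/
def plateau {δ : ℝ} (hδ : 0 < δ) : ContDiffBump (0 : ℝ) :=
  ⟨1, 1 + δ, one_pos, by linarith⟩

theorem plateau_eq_one {δ : ℝ} (hδ : 0 < δ) {t : ℝ} (ht : |t| ≤ 1) : plateau hδ t = 1 :=
  (plateau hδ).one_of_mem_closedBall (by simpa [plateau] using ht)

theorem plateau_eq_zero {δ : ℝ} (hδ : 0 < δ) {t : ℝ} (ht : 1 + δ ≤ |t|) : plateau hδ t = 0 :=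
  (plateau hδ).zero_of_le_dist (by simpa [plateau] using ht)

theorem exists_abs_deriv_plateau_le {δ : ℝ} (hδ : 0 < δ) :
    ∃ K, 0 ≤ K ∧ ∀ t, |deriv (plateau hδ) t| ≤ K := by
  have h1 : ContDiff ℝ 1 (plateau hδ) := (plateau hδ).contDiff
  have h2 : Continuous (deriv (plateau hδ)) := h1.continuous_deriv le_rfl
  obtain ⟨K, hK⟩ := h2.bounded_above_of_compact_support (plateau hδ).hasCompactSupport.deriv
  exact ⟨K, (norm_nonneg _).trans (hK 0), hK⟩

/-- The sum of the squared weights of a plateau function over the design points. -/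
theorem sum_plateau_sq_bounds {δ : ℝ} (hδ : 0 < δ) {n : ℕ} {z₀ h : ℝ} (hn : 0 < n) (hh : 0 < h)
    (h0 : (1 + δ) * h < z₀) (h1 : z₀ + h ≤ 1) :
    2 * (n * h) - 1 ≤ ∑ i : Fin n, plateau hδ ((((i : ℕ) + 1 : ℕ) / (n : ℝ) - z₀) / h) ^ 2 ∧
    ∑ i : Fin n, plateau hδ ((((i : ℕ) + 1 : ℕ) / (n : ℝ) - z₀) / h) ^ 2
      ≤ 2 * (1 + δ) * (n * h) + 1 := by
  have hn' : (0 : ℝ) < n := by exact_mod_cast hn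
  set f : ℕ → ℝ := fun k => plateau hδ (((k : ℝ) / n - z₀) / h) ^ 2 with hf
  have hsum : ∑ i : Fin n, plateau hδ ((((i : ℕ) + 1 : ℕ) / (n : ℝ) - z₀) / h) ^ 2
      = ∑ k ∈ Finset.Icc 1 n, f k := by
    rw [Fin.sum_univ_eq_sum_range (fun i => f (i + 1)) n, Finset.range_eq_Ico,
      Finset.sum_Ico_add' f 0 n 1]
    rfl
  have hf0 : ∀ k, 0 ≤ f k := fun k => sq_nonneg _
  have hf1 : ∀ k, f k ≤ 1 := fun k => pow_le_one₀ (plateau hδ).nonneg (plateau hδ).le_one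
  -- Both bounds count integers in an interval [A, B]; rounding the endpoints changes B - A by at
  -- most 1.
  have habs : ∀ (k : ℕ) (r : ℝ), |((k : ℝ) / n - z₀) / h| ≤ r ↔
      n * (z₀ - r * h) ≤ k ∧ k ≤ n * (z₀ + r * h) := by
    intro k r
    rw [abs_div, abs_of_pos hh, div_le_iff₀ hh, abs_le]
    constructor
    · rintro ⟨h2, h3⟩
      constructor
      · have : z₀ - r * h ≤ k / n := by linarith
        rw [le_div_iff₀ hn'] at this; linarith
      · have : (k : ℝ) / n ≤ z₀ + r * h := by linarith
        rw [div_le_iff₀ hn'] at this; linarith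
    · rintro ⟨h2, h3⟩
      constructor
      · have : z₀ - r * h ≤ k / n := by rw [le_div_iff₀ hn']; linarith
        linarith
      · have : (k : ℝ) / n ≤ z₀ + r * h := by rw [div_le_iff₀ hn']; linarith
        linarith
  rw [hsum]
  constructor
  · set A := (n : ℝ) * (z₀ - 1 * h)
    set B := (n : ℝ) * (z₀ + 1 * h)
    have hA : 0 < A := mul_pos hn' (by nlinarith)
    have hB : B ≤ n := mul_le_of_le_one_right hn'.le (by linarith)
    have hB0 : 0 ≤ B := by
      have : A ≤ B := mul_le_mul_of_nonneg_left (by linarith) hn'.le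
      linarith
    have hsub : Finset.Icc ⌈A⌉₊ ⌊B⌋₊ ⊆ Finset.Icc 1 n := by
      refine Finset.Icc_subset_Icc (Nat.ceil_pos.mpr hA) ?_
      exact_mod_cast (Nat.floor_le hB0).trans hB
    calc 2 * (n * h) - 1 ≤ ((Finset.Icc ⌈A⌉₊ ⌊B⌋₊).card : ℝ) := by
          rw [Nat.card_Icc]
          have h2 : B < ⌊B⌋₊ + 1 := Nat.lt_floor_add_one B
          have h3 : (⌈A⌉₊ : ℝ) < A + 1 := Nat.ceil_lt_add_one hA.le
          have h4 : ((⌊B⌋₊ + 1 : ℕ) : ℝ) - ⌈A⌉₊ ≤ ((⌊B⌋₊ + 1 - ⌈A⌉₊ : ℕ) : ℝ) := by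
            rw [sub_le_iff_le_add]
            exact_mod_cast Nat.sub_le_iff_le_add.mp le_rfl
          have h5 : B - A = 2 * (n * h) := by ring
          push_cast at h4
          linarith
      _ = ∑ k ∈ Finset.Icc ⌈A⌉₊ ⌊B⌋₊, (1 : ℝ) := by simp
      _ = ∑ k ∈ Finset.Icc ⌈A⌉₊ ⌊B⌋₊, f k := by
          refine Finset.sum_congr rfl fun k hk => ?_
          rw [Finset.mem_Icc] at hk
          have : |((k : ℝ) / n - z₀) / h| ≤ 1 :=
            (habs k 1).mpr ⟨Nat.ceil_le.mp hk.1, (Nat.le_floor_iff hB0).mp hk.2⟩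
          rw [hf]
          simp only [plateau_eq_one hδ this, one_pow]
      _ ≤ ∑ k ∈ Finset.Icc 1 n, f k :=
          Finset.sum_le_sum_of_subset_of_nonneg hsub fun k _ _ => hf0 k
  · set A := (n : ℝ) * (z₀ - (1 + δ) * h)
    set B := (n : ℝ) * (z₀ + (1 + δ) * h)
    have hA : 0 < A := mul_pos hn' (by linarith)
    have hBA : B - A = 2 * (1 + δ) * (n * h) := by ring
    have hAB : 0 ≤ B - A := by rw [hBA]; positivity
    calc ∑ k ∈ Finset.Icc 1 n, f k ≤ ∑ k ∈ Finset.Icc ⌈A⌉₊ ⌊B⌋₊, f k := by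
          rw [← Finset.sum_filter_ne_zero]
          refine Finset.sum_le_sum_of_subset_of_nonneg (fun k hk' => ?_) fun k _ _ => hf0 k
          have hk : f k ≠ 0 := (Finset.mem_filter.mp hk').2
          rw [Finset.mem_Icc]
          have : |((k : ℝ) / n - z₀) / h| ≤ 1 + δ := by
            by_contra hcon
            refine hk ?_
            rw [hf]
            simp only [plateau_eq_zero hδ (not_le.mp hcon).le]
            exact zero_pow two_ne_zero
          have h2 := (habs k (1 + δ)).mp this
          exact ⟨Nat.ceil_le.mpr h2.1, Nat.le_floor h2.2⟩
      _ ≤ ∑ k ∈ Finset.Icc ⌈A⌉₊ ⌊B⌋₊, (1 : ℝ) := Finset.sum_le_sum fun k _ => hf1 k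
      _ = ((⌊B⌋₊ + 1 - ⌈A⌉₊ : ℕ) : ℝ) := by simp
      _ ≤ 2 * (1 + δ) * (n * h) + 1 := by
          rw [← hBA]
          rcases le_total ⌈A⌉₊ (⌊B⌋₊ + 1) with hle | hle
          · rw [Nat.cast_sub hle]
            have h2 := Nat.le_ceil A
            have h3 := Nat.floor_le (show 0 ≤ B by linarith)
            push_cast
            linarith
          · rw [Nat.sub_eq_zero_of_le hle]
            push_cast
            linarith

/-- The least favourable parametric subfamily. -/
noncomputable def localAlt {δ : ℝ} (hδ : 0 < δ) (z₀ ρ h u x : ℝ) : ℝ :=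
  u / ρ * plateau hδ ((x - z₀) / h)

theorem localAlt_center {δ : ℝ} (hδ : 0 < δ) (z₀ ρ h u : ℝ) :
    localAlt hδ z₀ ρ h u z₀ = u / ρ := by
  simp [localAlt, plateau_eq_one hδ (t := 0) (by simp)]

theorem abs_localAlt_le {δ : ℝ} (hδ : 0 < δ) {z₀ ρ h u b : ℝ} (hρ : 0 < ρ) (hu : |u| ≤ b)
    (x : ℝ) : |localAlt hδ z₀ ρ h u x| ≤ b / ρ := by
  rw [localAlt, abs_mul, abs_div, abs_of_pos hρ, abs_of_nonneg (plateau hδ).nonneg]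
  have h0 : 0 ≤ |u| / ρ := by positivity
  exact (mul_le_of_le_one_right h0 (plateau hδ).le_one).trans
    (div_le_div_of_nonneg_right hu hρ.le)

theorem localAlt_mem_weakHolderClass {δ : ℝ} (hδ : 0 < δ) {K : ℝ}
    (hK : ∀ t, |deriv (plateau hδ) t| ≤ K) {β ε L z₀ c ρ b u : ℝ} {n : ℕ} (hρ : 0 < ρ)
    (hh : 0 < bandwidth β n) (hc : 0 ≤ c) (hu : |u| ≤ b) (hε : b / ρ ≤ 1 - ε)
    (hL : b / ρ * (K / bandwidth β n) ≤ L) :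
    localAlt hδ z₀ ρ (bandwidth β n) u ∈ weakHolderClass β ε L z₀ c n := by
  set h := bandwidth β n with hh_def
  have hcd : ContDiff ℝ 1 (localAlt hδ z₀ ρ h u) := by
    unfold localAlt
    exact contDiff_const.mul ((plateau hδ).contDiff.comp
      ((contDiff_id.sub contDiff_const).div_const _))
  refine ⟨⟨hcd.contDiffOn, fun x _ => (abs_localAlt_le hδ hρ hu x).trans hε, fun x hx => ?_⟩, ?_⟩
  · have hderiv : HasDerivAt (localAlt hδ z₀ ρ h u)
        (u / ρ * (deriv (plateau hδ) ((x - z₀) / h) * (1 / h))) x := by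
      have h1 : HasDerivAt (plateau hδ) (deriv (plateau hδ) ((x - z₀) / h)) ((x - z₀) / h) :=
        (((plateau hδ).contDiff (n := 1)).differentiable one_ne_zero _).hasDerivAt
      have h2 : HasDerivAt (fun x : ℝ => (x - z₀) / h) (1 / h) x :=
        ((hasDerivAt_id x).sub_const z₀).div_const h
      exact (h1.comp x h2).const_mul _
    rw [hderiv.hasDerivWithinAt.derivWithin (uniqueDiffOn_Icc zero_lt_one x hx)]
    refine le_trans ?_ hL
    have hb0 : 0 ≤ b := (abs_nonneg u).trans hu
    rw [abs_mul, abs_mul, abs_div, abs_of_pos hρ, abs_of_pos (one_div_pos.mpr hh), mul_one_div]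
    gcongr
    exact hK _
  -- The integrand vanishes because the curve is constant on [z₀ - h, z₀ + h].
  · have hO : Omega h z₀ (localAlt hδ z₀ ρ h u) = 0 := by
      rw [Omega]
      refine intervalIntegral.integral_zero_ae (ae_of_all _ fun t ht => ?_)
      rw [uIoc_of_le (by norm_num)] at ht
      rw [localAlt_center, localAlt, add_sub_cancel_left, mul_div_cancel_right₀ _ hh.ne',
        plateau_eq_one hδ (abs_le.mpr ⟨ht.1.le, ht.2⟩), mul_one, sub_self]
    rw [hO, abs_zero]
    exact mul_nonneg hc (Real.rpow_nonneg hh.le _)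

theorem le_normalized_robustRisk {δ : ℝ} (hδ : 0 < δ) {ς : ℝ} (hς : 1 ≤ ς) {z₀ ρ h b u : ℝ}
    (y0 : ℝ) (hρ : 0 < ρ) (hu : |u| ≤ b) (hb : b / ρ < 1) {n : ℕ} {T : (Fin n → ℝ) → ℝ}
    (hT : Measurable T) :
    ∫⁻ ξ, ENNReal.ofReal
        |ρ * T (recObs (fun k => u / ρ * plateau hδ (((k : ℝ) / n - z₀) / h)) y0 n ξ) - u|
        ∂stdGaussianPi n
      ≤ ENNReal.ofReal (gam z₀ (localAlt hδ z₀ ρ h u) ^ (-(1 / 2) : ℝ)) * ENNReal.ofReal ρ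
        * robustRisk ς y0 z₀ n T (localAlt hδ z₀ ρ h u) := by
  have hlt : |u / ρ| < 1 := by
    rw [abs_div, abs_of_pos hρ]
    exact (div_le_div_of_nonneg_right hu hρ.le).trans_lt hb
  have hgam : 1 ≤ ENNReal.ofReal (gam z₀ (localAlt hδ z₀ ρ h u) ^ (-(1 / 2) : ℝ)) := by
    rw [gam, localAlt_center, ENNReal.one_le_ofReal]
    have h1 : (u / ρ) ^ 2 < 1 := (sq_lt_one_iff_abs_lt_one _).mpr hlt
    exact Real.one_le_rpow_of_pos_of_le_one_of_nonpos (by linarith)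
      (by linarith [sq_nonneg (u / ρ)]) (by norm_num)
  have hrisk : ∫⁻ y, ENNReal.ofReal |T y - u / ρ|
      ∂obsLaw (localAlt hδ z₀ ρ h u) (gaussianPDFReal 0 1) y0 n
      ≤ robustRisk ς y0 z₀ n T (localAlt hδ z₀ ρ h u) := by
    unfold robustRisk
    rw [localAlt_center]
    exact le_iSup₂_of_le (gaussianPDFReal 0 1) (isNoiseDensity_gaussianPDFReal hς) le_rfl
  calc _ = ENNReal.ofReal ρ * ∫⁻ y, ENNReal.ofReal |T y - u / ρ|
        ∂obsLaw (localAlt hδ z₀ ρ h u) (gaussianPDFReal 0 1) y0 n := by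
        rw [lintegral_obsLaw_gaussianPDFReal _ _ _ (hT.sub_const _).abs.ennreal_ofReal,
          ← lintegral_const_mul' _ _ ENNReal.ofReal_ne_top]
        refine lintegral_congr fun ξ => ?_
        rw [← ENNReal.ofReal_mul hρ.le]
        congr 1
        have hmul : ∀ x : ℝ, ρ * |x| = |ρ * x| := fun x => by rw [abs_mul, abs_of_pos hρ]
        rw [hmul, mul_sub, mul_div_cancel₀ _ hρ.ne']
        rfl
    _ ≤ 1 * ENNReal.ofReal ρ * robustRisk ς y0 z₀ n T (localAlt hδ z₀ ρ h u) := by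
        rw [one_mul]; gcongr
    _ ≤ _ := by gcongr

/-! ### Asymptotics -/

theorem rate_sq {β : ℝ} (hβ : 0 < β) {n : ℕ} (hn : 0 < n) :
    rate β n ^ 2 = n * bandwidth β n := by
  have hn' : (0 : ℝ) < n := by exact_mod_cast hn
  rw [rate, bandwidth, ← Real.rpow_natCast, ← Real.rpow_mul hn'.le, mul_comm (n : ℝ),
    ← Real.rpow_add_one hn'.ne']
  congr 1
  field_simp
  push_cast
  ring

theorem tendsto_rate {β : ℝ} (hβ : 0 < β) : Tendsto (rate β) atTop atTop :=
  (tendsto_rpow_atTop (show 0 < β / (2 * β + 1) by positivity)).comp tendsto_natCast_atTop_atTop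

theorem tendsto_bandwidth {β : ℝ} (hβ : 0 < β) : Tendsto (bandwidth β) atTop (nhds 0) :=
  (tendsto_rpow_neg_atTop (show 0 < 1 / (2 * β + 1) by positivity)).comp
    tendsto_natCast_atTop_atTop

/-- The exponent is (β - 1)/(2β + 1). This is where β > 1 is needed: it makes the slopes of the
local alternatives vanish. -/
theorem tendsto_rate_mul_bandwidth {β : ℝ} (hβ : 1 < β) :
    Tendsto (fun n => rate β n * bandwidth β n) atTop atTop := by
  have hβ0 : 0 < β := by linarith
  have h : Tendsto (fun n : ℕ => (n : ℝ) ^ ((β - 1) / (2 * β + 1))) atTop atTop :=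
    (tendsto_rpow_atTop (show 0 < (β - 1) / (2 * β + 1) from
      div_pos (by linarith) (by linarith))).comp tendsto_natCast_atTop_atTop
  refine h.congr' ?_
  filter_upwards [eventually_gt_atTop 0] with n hn
  have hn' : (0 : ℝ) < n := by exact_mod_cast hn
  rw [rate, bandwidth, ← Real.rpow_add hn']
  congr 1
  ring

/-- A lower bound of the minimax risk for large samples, in terms of the half-width `b` of the
prior, the localization radius `a` and the tolerances `δ` and `η`. -/
theorem eventually_le_minimaxRisk {ς : ℝ} (hς : 1 ≤ ς) (y0 : ℝ) {z₀ : ℝ}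
    (hz₀ : z₀ ∈ Ioo (0 : ℝ) 1) {β : ℝ} (hβ : 1 < β) {L : ℝ} (hL : 0 < L) {c : ℕ → ℝ}
    (hc : ∀ n, 0 ≤ c n) {ε : ℝ} (hε : ε ∈ Ioo (0 : ℝ) 1) {a b δ η : ℝ} (ha : 0 < a)
    (hab : 2 * a < b) (hδ : 0 < δ) (hδ1 : δ < 1) (hη : 0 < η) :
    ∀ᶠ n in atTop, ENNReal.ofReal ((b - 2 * a) / b *
        (√((2 - 2 * δ) / (2 * Real.pi)) *
          (2 / (2 + 4 * δ) * (1 - Real.exp (-((2 + 4 * δ) * a ^ 2 / 2))))) *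
        (1 - η - 2 * Real.exp (-((2 - 2 * δ) * a ^ 2 / 2))))
      ≤ minimaxRisk ς y0 z₀ β ε L (c n) n := by
  obtain ⟨K, hK0, hK⟩ := exists_abs_deriv_plateau_le hδ
  have hb0 : 0 < b := by linarith
  have hβ0 : 0 < β := by linarith
  have hρ := tendsto_rate hβ0
  have hh := tendsto_bandwidth hβ0
  set C := (1 + y0 ^ 2) + (1 + gaussianSqVar * (2 * (1 + δ) + 1))
    + b * (9 + 2 * y0 ^ 2) * (2 * (1 + δ) + 1) with hC
  have hC0 : 0 ≤ C := by have := gaussianSqVar_nonneg; positivity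
  -- In order after positivity of n, the conditions serve to absorb constants into powers of ρ, keep
  -- the coefficients at most 1/2, enforce the bound 1 - ε, absorb rounding into δ, make the
  -- information concentrate, enforce the slope bound L, and place the needed parts of the window
  -- inside [0, 1].
  filter_upwards [eventually_gt_atTop 0, hρ.eventually_ge_atTop 1, hρ.eventually_ge_atTop (2 * b),
    hρ.eventually_ge_atTop (b / (1 - ε)), hρ.eventually_ge_atTop (1 / δ),
    hρ.eventually_ge_atTop (C / (δ * η)),
    (tendsto_rate_mul_bandwidth hβ).eventually_ge_atTop (b * K / L),
    hh.eventually_lt_const (show 0 < z₀ / (1 + δ) from div_pos hz₀.1 (by linarith)),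
    hh.eventually_lt_const (show 0 < 1 - z₀ by linarith [hz₀.2])]
    with n hn hρ1 hρ2 hρε hρδ hρC hρh hh0 hh1
  obtain ⟨m, rfl⟩ : ∃ m, n = m + 1 := ⟨n - 1, by omega⟩
  have hsq := rate_sq hβ0 hn
  have hhpos : 0 < bandwidth β (m + 1) := Real.rpow_pos_of_pos (by exact_mod_cast hn) _
  unfold minimaxRisk
  set ρ := rate β (m + 1)
  set h := bandwidth β (m + 1) with hh_def
  have hρ0 : 0 < ρ := by linarith
  refine le_iInf₂ fun T hT => ?_
  set w : ℕ → ℝ := fun k => plateau hδ (((k : ℝ) / ((m + 1 : ℕ) : ℝ) - z₀) / h) with hw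
  have hN := sum_plateau_sq_bounds hδ (z₀ := z₀) hn hhpos
    (by rw [lt_div_iff₀ (by linarith)] at hh0; linarith) (by linarith)
  rw [← hsq] at hN
  have hρsq : 0 < ρ ^ 2 := by positivity
  have h1ρ : 1 ≤ δ * ρ := by rwa [div_le_iff₀ hδ, mul_comm] at hρδ
  have hδρ : 1 ≤ δ * ρ ^ 2 := by nlinarith
  have hCρ : C ≤ δ * η * ρ := by
    rwa [div_le_iff₀ (by positivity), mul_comm] at hρC
  set N := ∑ i : Fin (m + 1), w (i + 1) ^ 2 with hNdef
  have hN1 : 2 * ρ ^ 2 - 1 ≤ N := hN.1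
  have hN2 : N ≤ 2 * (1 + δ) * ρ ^ 2 + 1 := hN.2
  have hN3 : N ≤ (2 * (1 + δ) + 1) * ρ ^ 2 := by nlinarith
  have hbρ : b / ρ ≤ 1 / 2 := by rw [div_le_iff₀ hρ0]; linarith
  -- Here N/ρ² lies between 2 - δ and 2 + 3δ; a further margin δ for random fluctuation gives lo = 2
  -- - 2δ and hi = 2 + 4δ. The estimator of u is ρT.
  refine le_of_forall_lintegral_recObs_le (w := w) (fun _ => (plateau hδ).nonneg)
    (fun _ => (plateau hδ).le_one) y0 hρ0 ha hab (by linarith) (by linarith) hη.le hbρ hδ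
    ?_ ?_ ?_ (hT.const_mul ρ) fun u hu => ?_
  · rw [le_div_iff₀ hρsq]
    linarith
  · rw [div_le_iff₀ hρsq]
    nlinarith
  · have h1 : gaussianSqVar * N / ρ ≤ gaussianSqVar * (2 * (1 + δ) + 1) * ρ := by
      rw [div_le_iff₀ hρ0]
      calc _ ≤ gaussianSqVar * ((2 * (1 + δ) + 1) * ρ ^ 2) :=
            mul_le_mul_of_nonneg_left hN3 gaussianSqVar_nonneg
        _ = _ := by ring
    have h2 : b / ρ * (9 + 2 * y0 ^ 2) * N ≤ b * (9 + 2 * y0 ^ 2) * (2 * (1 + δ) + 1) * ρ := by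
      calc _ ≤ b / ρ * (9 + 2 * y0 ^ 2) * ((2 * (1 + δ) + 1) * ρ ^ 2) :=
            mul_le_mul_of_nonneg_left hN3 (by positivity)
        _ = _ := by field_simp
    have h3 : 1 + y0 ^ 2 ≤ (1 + y0 ^ 2) * ρ := le_mul_of_one_le_right (by positivity) hρ1
    have h4 : C * ρ ≤ δ * η * ρ * ρ := mul_le_mul_of_nonneg_right hCρ hρ0.le
    rw [hC] at h4
    linarith
  · have hmem : localAlt hδ z₀ ρ h u ∈ weakHolderClass β ε L z₀ (c (m + 1)) (m + 1) := by
      refine localAlt_mem_weakHolderClass hδ hK hρ0 hhpos (hc _) hu ?_ ?_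
      · rw [div_le_iff₀ hρ0]
        rw [div_le_iff₀ (by linarith [hε.2])] at hρε
        linarith
      · rw [div_mul_div_comm, div_le_iff₀ (by positivity)]
        rw [div_le_iff₀ hL] at hρh
        linarith
    exact (le_normalized_robustRisk hδ hς y0 hρ0 hu (by linarith) hT).trans
      (le_iSup₂_of_le (localAlt hδ z₀ ρ h u) hmem le_rfl)

theorem tendsto_lower_bound :
    Tendsto (fun k : ℕ => ((k : ℝ) ^ 2 - 2 * k) / (k : ℝ) ^ 2 *
        (√((2 - 2 * (1 / (k : ℝ))) / (2 * Real.pi)) *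
          (2 / (2 + 4 * (1 / (k : ℝ))) *
            (1 - Real.exp (-((2 + 4 * (1 / (k : ℝ))) * (k : ℝ) ^ 2 / 2))))) *
        (1 - 1 / (k : ℝ) - 2 * Real.exp (-((2 - 2 * (1 / (k : ℝ))) * (k : ℝ) ^ 2 / 2))))
      atTop (nhds (√Real.pi)⁻¹) := by
  have h0 : Tendsto (fun k : ℕ => 1 / (k : ℝ)) atTop (nhds 0) := tendsto_one_div_atTop_nhds_zero_nat
  have hk2 : Tendsto (fun k : ℕ => (k : ℝ) ^ 2) atTop atTop :=
    (tendsto_pow_atTop two_ne_zero).comp tendsto_natCast_atTop_atTop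
  have h1 : Tendsto (fun k : ℕ => ((k : ℝ) ^ 2 - 2 * k) / (k : ℝ) ^ 2) atTop (nhds 1) := by
    have : Tendsto (fun k : ℕ => 1 - 2 * (1 / (k : ℝ))) atTop (nhds (1 - 2 * 0)) :=
      (h0.const_mul 2).const_sub 1
    rw [mul_zero, sub_zero] at this
    refine this.congr' ?_
    filter_upwards [eventually_gt_atTop 0] with k hk
    have : (k : ℝ) ≠ 0 := by exact_mod_cast hk.ne'
    field_simp
  have hlo : Tendsto (fun k : ℕ => 2 - 2 * (1 / (k : ℝ))) atTop (nhds 2) := by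
    simpa using (h0.const_mul 2).const_sub 2
  have hhi : Tendsto (fun k : ℕ => 2 + 4 * (1 / (k : ℝ))) atTop (nhds 2) := by
    simpa using (h0.const_mul 4).const_add 2
  have hexp : ∀ f : ℕ → ℝ, Tendsto f atTop (nhds 2) →
      Tendsto (fun k : ℕ => Real.exp (-(f k * (k : ℝ) ^ 2 / 2))) atTop (nhds 0) := fun f hf =>
    Real.tendsto_exp_neg_atTop_nhds_zero.comp
      ((hf.pos_mul_atTop two_pos hk2).atTop_div_const two_pos)
  have h2 : Tendsto (fun k : ℕ => √((2 - 2 * (1 / (k : ℝ))) / (2 * Real.pi))) atTop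
      (nhds √(2 / (2 * Real.pi))) := (hlo.div_const _).sqrt
  have h3 := (tendsto_const_nhds (x := (2 : ℝ))).div hhi two_ne_zero
  have h4 := (hexp _ hhi).const_sub 1
  have h5 := (h0.const_sub 1).sub ((hexp _ hlo).const_mul 2)
  have h6 := (h1.mul (h2.mul (h3.mul h4))).mul h5
  have hval : (√Real.pi)⁻¹
      = 1 * (√(2 / (2 * Real.pi)) * (2 / 2 * (1 - 0))) * (1 - 0 - 2 * 0) := by
    rw [div_mul_cancel_left₀ two_ne_zero, Real.sqrt_inv]
    ring
  rw [hval]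
  exact h6

end NonparamAR

theorem theorem3p1 (ς : ℝ) (hς : 1 ≤ ς) (y0 : ℝ)
    (z₀ : ℝ) (hz₀ : z₀ ∈ Set.Ioo (0 : ℝ) 1)
    (α β : ℝ) (hα : α ∈ Set.Ioo (0 : ℝ) 1) (hβ : β = 1 + α)
    (L : ℝ) (hL : 0 < L)
    (c : ℕ → ℝ) (hc_nonneg : ∀ n, 0 ≤ c n)
    (hc_lim : Filter.Tendsto c Filter.atTop (nhds 0))
    (ε : ℝ) (hε : ε ∈ Set.Ioo (0 : ℝ) 1) :
    ∫⁻ x, ENNReal.ofReal |x| ∂(ProbabilityTheory.gaussianReal 0 (1 / 2)) ≤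
      Filter.liminf (fun n : ℕ => NonparamAR.minimaxRisk ς y0 z₀ β ε L (c n) n)
        Filter.atTop := by
  rw [NonparamAR.lintegral_abs_gaussianReal_half]
  -- The choice a = k, b = k², δ = η = 1/k makes a → ∞ while a/b → 0; 2a < b requires k > 2. For
  -- each fixed k the bound holds for all large n, so the limit in k is taken after the liminf in n.
  refine le_of_tendsto (ENNReal.tendsto_ofReal NonparamAR.tendsto_lower_bound) ?_
  filter_upwards [eventually_gt_atTop 2] with k hk
  have hk2 : (2 : ℝ) < k := by exact_mod_cast hk
  have hk0 : (0 : ℝ) < k := by linarith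
  exact le_liminf_of_le (by isBoundedDefault) (NonparamAR.eventually_le_minimaxRisk hς y0 hz₀
    (by linarith [hα.1]) hL hc_nonneg hε hk0 (by nlinarith) (by positivity)
    (by rw [div_lt_one hk0]; linarith) (by positivity))
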